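/- Lemma 2.3. All graphs are finite and simple. The Laplacian matrix of a graph $G$ is $\mathrm L(G)=\mathrm D(G)-\mathrm A(G)$, where $\mathrm D(G)$ is the diagonal matrix of vertex degrees and $\mathrm A(G)$ is the adjacency matrix; the Laplacian spectrum of $G$ is the multiset of eigenvalues of $\mathrm L(G)$. A graph $G$ is determined by its Laplacian spectrum if every graph with the same Laplacian spectrum as $G$ is isomorphic to $G$. A graph is sun-like if it is connected and deleting all its vertices of degree $1$ yields a cycle $C$. For $i\ge 1$, a vertex of $C$ with exactly $i$ leaves attached to it (equivalently, a vertex of degree $i+2$) is called an $i$-hub; a hub is an $i$-hub for some $i\ge 1$. For integers $k\ge 1$ and $\ell\ge\max(12k,15)$, a graph $G$ is $(\ell,k)$-nice if - $G$ is sun-like, and its unique cycle $C$ has length $\ell$; - $G$ has exactly $k+1$ hubs, one of which is a $1$-hub and the other $k$ of which are $2$-hubs; - for some orientation of $C$, walking around $C$ in this direction starting from the $1$-hub, the first $2$-hub is met after distance exactly $4$, and each subsequent $2$-hub is met at distance $4$ or $6$ after the previous one. Then, for all integers $k\ge 1$ and $\ell\ge\max(12k,15)$, every $(\ell,k)$-nice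 graph is determined by its Laplacian spectrum. -/

import Mathlib

universe u v

namespace SimpleGraph

/-- The vertices which remain after deleting all vertices of degree 1. In a sun-like graph
these are exactly the vertices of its unique cycle. -/
def core {V : Type u} [Fintype V] (G : SimpleGraph V) [DecidableRel G.Adj] : Set V :=
  {v | G.degree v ≠ 1}

/-- A graph is *sun-like* if it is connected and deleting all its degree-1 vertices yields a
cycle (of some length `m ≥ 3`). -/
def IsSunLike {V : Type u} [Fintype V] (G : SimpleGraph V) [DecidableRel G.Adj] : Prop :=
  G.Connected ∧ ∃ m : ℕ, 3 ≤ m ∧ Nonempty (cycleGraph m ≃g G.induce G.core)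

/-- In a sun-like graph, a vertex of the cycle with exactly `i ≥ 1` leaves attached to it,
equivalently a vertex of degree `i + 2`, is called an `i`-*hub*. -/
def IsHubOfOrder {V : Type u} [Fintype V] (G : SimpleGraph V) [DecidableRel G.Adj]
    (i : ℕ) (w : V) : Prop :=
  1 ≤ i ∧ G.degree w = i + 2

/-- `(ℓ, k)`-nice graphs. The isomorphism `c` labels the cycle of the sun-like graph `G` by
`0, 1, …, ℓ - 1` in cyclic order, that is, it fixes an orientation and a starting point, and
`p 0, p 1, …, p k` are the successive positions of the hubs. The walk starts at the 1-hub, which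
has position `p 0 = 0`; the first 2-hub comes after distance 4, and each later 2-hub comes at
distance 4 or 6 after the previous one. There are no hubs besides these `k + 1`. -/
def IsNice {V : Type u} [Fintype V] (G : SimpleGraph V) [DecidableRel G.Adj] (ℓ k : ℕ) : Prop :=
  1 ≤ k ∧ max (12 * k) 15 ≤ ℓ ∧ G.IsSunLike ∧
    ∃ (c : cycleGraph ℓ ≃g G.induce G.core) (p : Fin (k + 1) → Fin ℓ),
      (p 0 : ℕ) = 0 ∧
      (∀ i : Fin k, (p i.succ : ℕ) = p i.castSucc + 4 ∨
        ((i : ℕ) ≠ 0 ∧ (p i.succ : ℕ) = p i.castSucc + 6)) ∧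
      (∀ w : V, G.IsHubOfOrder 1 w ↔ w = c (p 0)) ∧
      (∀ w : V, G.IsHubOfOrder 2 w ↔ ∃ i : Fin k, w = c (p i.succ)) ∧
      (∀ (j : ℕ) (w : V), 3 ≤ j → ¬ G.IsHubOfOrder j w)

/-- The Laplacian spectrum: the multiset of eigenvalues, with multiplicity, of the Laplacian
matrix `D - A`. This matrix is real symmetric, so its characteristic polynomial splits over `ℝ`
and its real roots are all its eigenvalues. -/
noncomputable def lapSpectrum {V : Type u} [Fintype V] [DecidableEq V] (G : SimpleGraph V)
    [DecidableRel G.Adj] : Multiset ℝ :=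
  (G.lapMatrix ℝ).charpoly.roots

/-- `G` is *determined by its Laplacian spectrum* if every finite graph with the same Laplacian
spectrum is isomorphic to `G`. -/
def IsDeterminedByLapSpectrum {V : Type u} [Fintype V] [DecidableEq V] (G : SimpleGraph V)
    [DecidableRel G.Adj] : Prop :=
  ∀ (W : Type v) [Fintype W] [DecidableEq W] (H : SimpleGraph W) [DecidableRel H.Adj],
    H.lapSpectrum = G.lapSpectrum → Nonempty (H ≃g G)

end SimpleGraph

namespace SimpleGraph

open Matrix Finset

/-! ### Cofactors of the Laplacian and the all-ones perturbation. -/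

section Adjugate

variable {V : Type*} [Fintype V] [DecidableEq V] (G : SimpleGraph V) [DecidableRel G.Adj]

/-! The proof has two stages: the spectrum first fixes the cycle length and the hub counts, and then
the positions of the hubs.

For the counts, let `H` be cospectral to a nice graph. The spectrum gives the numbers of vertices
and edges and the sum of squared degrees. It also gives `det (L + J)`, where `J` is the all-ones
matrix. This determinant is nonzero exactly for connected graphs and encodes the common cofactor of
`L`, which for a unicyclic graph is the length of the cycle. No two hubs of a nice graph are
adjacent, so its eigenvalues lie below `6` and `H` has maximum degree at most `4`. The degree sums,
together with the fact that cycle vertices are not leaves, then force `H` to be a sun graph with one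
1-hub and `k` 2-hubs (`exists_sunGraph_iso_of_lapSpectrum_eq`).

For the positions, evaluate `det ((1 - x) ^ 2 + x L)` over `ℤ⟦X⟧`. Eliminating the leaves by a Schur
complement leaves a diagonal perturbation of the cycle matrix `1 + x ^ 2 - x A`, whose inverse is,
up to a scalar, the explicit kernel `x ^ d + x ^ (n - d)`. After cancelling factors that depend only
on the counts, the determinant of the hub interaction matrix is a spectral invariant
(`exists_det_hubMatrix_eq`). It is used through two truncations.

Weights of 2-hubs are even, so modulo `4` only pairs containing the 1-hub survive. This determines
the distance of each 2-hub from the 1-hub, so each 2-hub is at its original place or at the mirror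
image (`indicator_add_indicator_neg_eq`).

Hubs are at least `4` apart, so terms of order three vanish modulo `X ^ 15`, and the remaining pair
sum counts pairs of 2-hubs at each distance up to `6`. Moving one of two 2-hubs to the opposite side
takes their distance beyond `6`, and no other pair can make up for the loss. Consecutive 2-hubs,
being `4` or `6` apart, thus stay on one side (`side_eq_of_pairSum`), and `H` is the original graph
up to a symmetry of the cycle. -/

theorem lapMatrix_apply {R : Type*} [AddGroupWithOne R] (a b : V) :
    G.lapMatrix R a b = (if a = b then (G.degree a : R) else 0) - if G.Adj a b then 1 else 0 := by
  simp [lapMatrix, degMatrix, Matrix.diagonal_apply, adjMatrix_apply]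

theorem map_lapMatrix {R S : Type*} [Ring R] [Ring S] (f : R →+* S) :
    (G.lapMatrix R).map f = G.lapMatrix S := by
  ext a b
  simp only [Matrix.map_apply, lapMatrix_apply, map_sub]
  split_ifs <;> simp

/-- For a connected graph all cofactors of the Laplacian matrix agree. -/
theorem Connected.exists_adjugate_lapMatrix_eq (hG : G.Connected) :
    ∃ c : ℝ, ∀ a b, (G.lapMatrix ℝ).adjugate a b = c := by
  have := hG.nonempty
  have hcol : ∀ j a b, (G.lapMatrix ℝ).adjugate a j = (G.lapMatrix ℝ).adjugate b j := by
    intro j a b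
    -- Since `det L = 0`, each column of the adjugate lies in the kernel of `L`, which for a
    -- connected graph consists of the constants.
    have h0 : G.lapMatrix ℝ *ᵥ (fun i => (G.lapMatrix ℝ).adjugate i j) = 0 := by
      ext i
      have := congrFun (congrFun (Matrix.mul_adjugate (G.lapMatrix ℝ)) i) j
      rw [det_lapMatrix_eq_zero, zero_smul] at this
      simpa [Matrix.mul_apply, Matrix.mulVec, dotProduct] using this
    exact (G.lapMatrix_mulVec_eq_zero_iff_forall_reachable.1 h0) a b (hG.preconnected a b)
  have hsymm : ∀ a b, (G.lapMatrix ℝ).adjugate a b = (G.lapMatrix ℝ).adjugate b a := fun a b =>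
    (Matrix.IsSymm.adjugate (G.isSymm_lapMatrix (R := ℝ))).apply b a
  obtain ⟨v⟩ := hG.nonempty
  exact ⟨(G.lapMatrix ℝ).adjugate v v, fun a b => by rw [hcol b a v, hsymm, hcol v b v]⟩

theorem degree_induce_compl_singleton (u : V) (a : ({u}ᶜ : Set V)) :
    (G.degree (a : V) : ℝ) = (G.induce {u}ᶜ).degree a + if G.Adj a u then 1 else 0 := by
  rw [degree_eq_sum_if_adj, degree_eq_sum_if_adj,
    Fintype.sum_eq_add_sum_subtype_ne (fun j => if G.Adj (a : V) j then (1 : ℝ) else 0) u, add_comm]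
  rfl

/-- Deleting a leaf does not change the remaining principal cofactors of the Laplacian. -/
theorem adjugate_lapMatrix_induce_compl_singleton {u : V} (hu : G.degree u = 1)
    (v : ({u}ᶜ : Set V)) :
    (G.lapMatrix ℝ).adjugate v v = ((G.induce {u}ᶜ).lapMatrix ℝ).adjugate v v := by
  obtain ⟨w, huw, hw⟩ := degree_eq_one_iff_existsUnique_adj.1 hu
  have hvu : (v : V) ≠ u := v.2
  -- Schur complement with respect to the block of the leaf, which is the scalar `1`. The correction
  -- lowers the diagonal entry of the leaf's neighbour by one, as deleting the leaf does. If that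
  -- neighbour is `v`, its row has been replaced by a unit vector and there is no correction.
  rw [adjugate_apply, adjugate_apply, det_toBlock _ (· ∈ ({u}ᶜ : Set V))]
  set M := (G.lapMatrix ℝ).updateRow (v : V) (Pi.single (v : V) 1) with hM
  have hMu : ∀ b, M u b = G.lapMatrix ℝ u b := fun b => by
    rw [hM, updateRow_ne hvu.symm]
  have hD : toBlock M (fun j => ¬ j ∈ ({u}ᶜ : Set V)) (fun j => ¬ j ∈ ({u}ᶜ : Set V)) = 1 := by
    ext ⟨a, ha⟩ ⟨b, hb⟩
    obtain rfl : a = u := by simpa using ha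
    obtain rfl : b = a := by simpa using hb
    simp [toBlock_apply, hMu, lapMatrix_apply, hu]
  rw [hD, det_fromBlocks_one₂₂]
  congr 1
  ext a b
  have hsum : ∀ f : {j // ¬ j ∈ ({u}ᶜ : Set V)} → ℝ, ∑ j, f j = f ⟨u, by simp⟩ := by
    intro f
    refine Fintype.sum_eq_single _ ?_
    rintro ⟨x, hx⟩ hne
    exact absurd (Subtype.ext (by simpa using hx)) hne
  have hau : (a : V) ≠ u := a.2
  have hbu : (b : V) ≠ u := b.2
  rw [Matrix.sub_apply, mul_apply, hsum]
  simp only [toBlock_apply, hMu]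
  by_cases hav : a = v
  · subst hav
    simp only [hM, updateRow_self, Pi.single_apply, hvu.symm, if_false, zero_mul, sub_zero]
    simp only [Subtype.ext_iff]
  · have hav' : (a : V) ≠ v := fun h => hav (Subtype.ext h)
    rw [updateRow_ne hav, hM, updateRow_ne hav', lapMatrix_apply, lapMatrix_apply, lapMatrix_apply,
      lapMatrix_apply, if_neg hau, if_neg hbu.symm, degree_induce_compl_singleton]
    by_cases hab : a = b
    · subst hab
      simp [G.adj_comm u a]
      split_ifs <;> simp
    · have hab' : (a : V) ≠ b := fun h => hab (Subtype.ext h)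
      have : ¬ (G.Adj a u ∧ G.Adj u b) := fun ⟨h1, h2⟩ =>
        hab' ((hw _ h1.symm).trans (hw _ h2).symm)
      simp only [hab, hab', if_false, comap_adj, Function.Embedding.subtype_apply]
      by_cases h1 : G.Adj a u
      · have h2 : ¬ G.Adj u b := fun h => this ⟨h1, h⟩
        simp [h2]
      · simp [h1]

/-- The all-ones perturbation of the Laplacian in terms of the cofactors. -/
theorem det_lapMatrix_add_one [Nonempty V] {c : ℝ}
    (hc : ∀ a b, (G.lapMatrix ℝ).adjugate a b = c) :
    (G.lapMatrix ℝ + Matrix.of fun _ _ => 1).det = Fintype.card V ^ 2 * c := by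
  obtain ⟨v⟩ := ‹Nonempty V›
  set L := G.lapMatrix ℝ
  set M : Matrix V V ℝ := L + Matrix.of fun _ _ => 1 with hM
  have hcolsum : ∀ j, ∑ i, L i j = 0 := by
    intro j
    have h := congrFun (G.lapMatrix_mulVec_const_eq_zero (R := ℝ)) j
    simp only [mulVec, dotProduct, mul_one, Pi.zero_apply] at h
    rw [← h]
    exact sum_congr rfl fun i _ => (G.isSymm_lapMatrix (R := ℝ)).apply j i
  have h1 : M.det = (M.updateRow v (∑ k, (1 : ℝ) • M k)).det := by
    rw [det_updateRow_sum, one_smul]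
  have h2 : (∑ k, (1 : ℝ) • M k) = (Fintype.card V : ℝ) • fun _ => (1 : ℝ) := by
    ext j
    simp only [hM, Finset.sum_apply, Pi.smul_apply, Matrix.add_apply, of_apply, smul_eq_mul, one_mul,
      sum_add_distrib, hcolsum]
    simp
  -- Once row `v` is all ones, subtracting it from the other rows removes the perturbation.
  have h3 : (M.updateRow v fun _ => (1 : ℝ)).det = (L.updateRow v fun _ => (1 : ℝ)).det := by
    refine det_eq_of_forall_row_eq_smul_add_const (fun i => if i = v then 0 else 1) v (by simp) ?_
    intro i j
    by_cases hi : i = v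
    · subst hi; simp
    · simp [hi, hM]
  have h4 : (L.updateRow v fun _ => (1 : ℝ)).det = Fintype.card V * c := by
    rw [← det_transpose, ← updateCol_transpose]
    have := cramer_eq_adjugate_mulVec Lᵀ (fun _ => (1 : ℝ))
    rw [← cramer_apply, this, (G.isSymm_lapMatrix (R := ℝ)).eq]
    simp [mulVec, dotProduct, L, hc]
  rw [h1, h2, det_updateRow_smul, h3, h4]
  ring

end Adjugate

theorem lapMatrix_submatrix_iso {V W R : Type*} [Ring R] [Fintype V] [DecidableEq V] [Fintype W]
    [DecidableEq W] {G : SimpleGraph V} {H : SimpleGraph W} [DecidableRel G.Adj]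
    [DecidableRel H.Adj] (e : G ≃g H) :
    (H.lapMatrix R).submatrix e e = G.lapMatrix R := by
  ext a b
  simp only [submatrix_apply, lapMatrix_apply, e.map_adj_iff, EmbeddingLike.apply_eq_iff_eq,
    e.degree_eq]

/-! ### The Laplacian of the cycle as a product of cyclic difference matrices. -/

section CyclicShift

variable (m : ℕ)

/-- `1 - C` where `C` is the cyclic shift. -/
def cyclicDiff : Matrix (Fin (m + 1)) (Fin (m + 1)) ℝ :=
  Matrix.of fun a b => (if a = b then 1 else 0) - if b = a + 1 then 1 else 0

theorem fin_eq_of_forall_eq_add_one {α : Type*} {m : ℕ} {y : Fin (m + 1) → α}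
    (h : ∀ a, y a = y (a + 1)) (a b : Fin (m + 1)) : y a = y b := by
  have h0 : ∀ a, y a = y 0 := by
    intro a
    induction a using Fin.induction with
    | zero => rfl
    | succ i ih => rw [← ih, h i.castSucc, Fin.coeSucc_eq_succ]
  rw [h0 a, h0 b]

theorem det_cyclicDiff : (cyclicDiff m).det = 0 := by
  refine exists_mulVec_eq_zero_iff.1 ⟨fun _ => 1, fun h => ?_, ?_⟩
  · simpa using congrFun h 0
  · ext a
    simp [cyclicDiff, mulVec, dotProduct, sum_sub_distrib]

/-- Both kernels of `1 - C` consist of constants, so all entries of the adjugate agree. The entry at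
`(0, 0)` is the determinant of a triangular matrix with unit diagonal. -/
theorem adjugate_cyclicDiff (a b : Fin (m + 1)) : (cyclicDiff m).adjugate a b = 1 := by
  have hcol : ∀ j a b, (cyclicDiff m).adjugate a j = (cyclicDiff m).adjugate b j := by
    intro j
    refine fin_eq_of_forall_eq_add_one fun a => ?_
    have := congrFun (congrFun (Matrix.mul_adjugate (cyclicDiff m)) a) j
    rw [det_cyclicDiff, zero_smul, mul_apply] at this
    simp only [cyclicDiff, of_apply, sub_mul, ite_mul, one_mul, zero_mul, sum_sub_distrib,
      sum_ite_eq, sum_ite_eq', mem_univ, if_true, Matrix.zero_apply] at this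
    exact sub_eq_zero.1 this
  have hrow : ∀ i a b, (cyclicDiff m).adjugate i a = (cyclicDiff m).adjugate i b := by
    intro i
    refine fin_eq_of_forall_eq_add_one fun a => ?_
    have := congrFun (congrFun (Matrix.adjugate_mul (cyclicDiff m)) i) (a + 1)
    rw [det_cyclicDiff, zero_smul, mul_apply] at this
    simp only [cyclicDiff, of_apply, mul_sub, mul_ite, mul_one, mul_zero, sum_sub_distrib,
      sum_ite_eq, sum_ite_eq', mem_univ, if_true, Matrix.zero_apply, add_left_inj] at this
    exact (sub_eq_zero.1 this).symm
  rw [hcol b a 0, hrow 0 b 0, adjugate_fin_succ_eq_det_submatrix,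
    det_of_isUpperTriangular]
  · refine (by simp : ∀ x : ℝ, x = 1 → (-1) ^ ((0 : Fin (m + 1)) + 0 : ℕ) * x = 1) _
      (prod_eq_one fun i _ => ?_)
    have : ¬ i.succ = i.succ + 1 := by
      intro h
      have h1 : (1 : Fin (m + 1)) = 0 := by simpa using h.symm
      have hm : m ≠ 0 := by rintro rfl; exact i.elim0
      simp [Fin.ext_iff, Nat.mod_eq_of_lt, hm] at h1
    simp [cyclicDiff, this]
  · intro i j hij
    have hij' : j < i := hij
    have h1 : ¬ i = j := hij'.ne'
    have h2 : ¬ j.succ = i.succ + 1 := by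
      intro h
      by_cases hi : i.succ = Fin.last m
      · rw [hi, Fin.last_add_one] at h
        exact Fin.succ_ne_zero _ h
      · have := Fin.val_add_one_of_lt (Fin.lt_last_iff_ne_last.2 hi)
        rw [← h] at this
        simp only [Fin.val_succ] at this
        omega
    simp [cyclicDiff, h1, h2]

end CyclicShift

theorem lapMatrix_cycleGraph (m : ℕ) :
    (cycleGraph (m + 3)).lapMatrix ℝ = cyclicDiff (m + 2) * (cyclicDiff (m + 2))ᵀ := by
  -- Length at least three keeps the two neighbours of a vertex distinct.
  have h2 : ∀ a : Fin (m + 3), a + 1 + 1 ≠ a := by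
    intro a h
    rw [add_assoc, add_eq_left] at h
    exact absurd h (ne_of_beq_false rfl)
  ext a b
  rw [mul_apply, lapMatrix_apply, cycleGraph_degree_three_le]
  simp only [cyclicDiff, of_apply, transpose_apply, mul_sub, sub_mul, ite_mul, one_mul, zero_mul,
    sum_sub_distrib, sum_ite_eq, mem_univ, if_true, sum_ite_eq', add_left_inj, cycleGraph_adj,
    sub_eq_iff_eq_add']
  by_cases hab : a = b
  · subst hab
    simp
    norm_num
  · have hba : ¬ b = a := fun h => hab h.symm
    by_cases h1 : a = b + 1
    · subst h1
      simp [(h2 b).symm]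
    · by_cases h3 : b = a + 1
      · subst h3
        simp [h1]
      · simp [hab, hba, h1, h3]

theorem adjugate_lapMatrix_cycleGraph (m : ℕ) (a b : Fin (m + 3)) :
    ((cycleGraph (m + 3)).lapMatrix ℝ).adjugate a b = (m + 3 : ℕ) := by
  rw [lapMatrix_cycleGraph, adjugate_mul_distrib, ← adjugate_transpose, mul_apply]
  simp only [transpose_apply, adjugate_cyclicDiff]
  simp

/-! ### Connected graphs with as many edges as vertices. -/

theorem two_le_degree_of_copy {V : Type*} [Fintype V] {G : SimpleGraph V} [DecidableRel G.Adj]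
    {m : ℕ} (f : Copy (cycleGraph (m + 3)) G) (a : Fin (m + 3)) : 2 ≤ G.degree (f a) := by
  have := f.degree_le a
  rwa [cycleGraph_degree_three_le] at this

theorem exists_copy_cycleGraph {V : Type*} [Fintype V] {G : SimpleGraph V} [DecidableRel G.Adj]
    (hG : G.Connected) (hE : #G.edgeFinset = Fintype.card V) :
    ∃ m, Nonempty (Copy (cycleGraph (m + 3)) G) := by
  have h : ¬ G.IsAcyclic := by
    intro h
    have := (IsTree.mk hG h).card_edgeFinset
    omega
  rw [isAcyclic_iff_free_cycleGraph] at h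
  push Not at h
  obtain ⟨n, hn, h⟩ := h
  obtain ⟨m, rfl⟩ := Nat.exists_eq_add_of_le' hn
  exact ⟨m, h⟩

/-- In a connected graph with as many edges as vertices, a cycle is induced, and its length is the
common value of the cofactors of the Laplacian matrix. -/
theorem unicyclic_copy {V : Type u} [Fintype V] [DecidableEq V] {G : SimpleGraph V}
    [DecidableRel G.Adj] (hG : G.Connected) (hE : #G.edgeFinset = Fintype.card V) {m : ℕ}
    (f : Copy (cycleGraph (m + 3)) G) :
    (∀ a b, G.Adj (f a) (f b) → (cycleGraph (m + 3)).Adj a b) ∧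
      ∀ a b, (G.lapMatrix ℝ).adjugate a b = (m + 3 : ℕ) := by
  induction h : Fintype.card V generalizing V with
  | zero =>
    exact absurd (Fintype.card_eq_zero_iff.1 h) (not_isEmpty_iff.2 hG.nonempty)
  | succ n ih =>
    -- Strip leaves one at a time. Cofactors do not change, and the cycle survives because its
    -- vertices have degree at least two.
    by_cases hleaf : ∃ u, G.degree u = 1
    · obtain ⟨u, hu⟩ := hleaf
      have hfu : ∀ a, f a ∈ ({u}ᶜ : Set V) := by
        intro a ha
        have := two_le_degree_of_copy f a
        rw [Set.mem_singleton_iff.1 ha] at this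
        omega
      have hconn := hG.induce_compl_singleton_of_degree_eq_one hu
      have hcard : Fintype.card ({u}ᶜ : Set V) = n := by
        rw [Fintype.card_compl_set, h]; simp
      have hE' : #(G.induce {u}ᶜ).edgeFinset = Fintype.card ({u}ᶜ : Set V) := by
        rw [card_edgeFinset_induce_compl_singleton, card_edgeFinset_deleteIncidenceSet, hE, h, hu,
          hcard]
        rfl
      let f' : Copy (cycleGraph (m + 3)) (G.induce {u}ᶜ) :=
        ⟨⟨fun a => ⟨f a, hfu a⟩, fun {a b} hab => f.toHom.map_adj hab⟩,
          fun a b hab => f.injective (congrArg Subtype.val hab)⟩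
      obtain ⟨h1, h2⟩ := ih hconn hE' f' hcard
      refine ⟨fun a b hab => h1 a b hab, ?_⟩
      obtain ⟨c, hc⟩ := hG.exists_adjugate_lapMatrix_eq
      have hc' : c = (m + 3 : ℕ) := by
        rw [← hc (f 0) (f 0), ← h2 ⟨f 0, hfu 0⟩ ⟨f 0, hfu 0⟩]
        exact G.adjugate_lapMatrix_induce_compl_singleton hu ⟨f 0, hfu 0⟩
      intro a b
      rw [hc, hc']
    · push Not at hleaf
      have hnt : Nontrivial V := f.injective.nontrivial
      have hpos : ∀ v, 2 ≤ G.degree v := by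
        intro v
        have h1 := hG.preconnected.degree_pos_of_nontrivial v
        have h2 := hleaf v
        omega
      -- Without leaves all degrees are at least two while their mean is two. The graph is
      -- 2-regular, so by connectedness the cycle is all of it.
      have hdeg : ∀ v, G.degree v = 2 := by
        have hs := G.sum_degrees_eq_twice_card_edges
        rw [hE] at hs
        have hs' : ∑ v : V, 2 = ∑ v, G.degree v := by
          rw [hs]; simp [mul_comm]
        intro v
        exact ((sum_eq_sum_iff_of_le fun v _ => hpos v).1 hs' v (mem_univ v)).symm
      have hnbr : ∀ a v, G.Adj (f a) v → ∃ b, (cycleGraph (m + 3)).Adj a b ∧ f b = v := by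
        intro a v hav
        have hsub : ((cycleGraph (m + 3)).neighborFinset a).image f ⊆ G.neighborFinset (f a) := by
          intro x hx
          obtain ⟨b, hb, rfl⟩ := mem_image.1 hx
          rw [mem_neighborFinset] at hb ⊢
          exact f.toHom.map_adj hb
        have heq := eq_of_subset_of_card_le hsub (by
          rw [card_image_of_injective _ (show Function.Injective (fun a => f a) from f.injective),
            card_neighborFinset_eq_degree,
            card_neighborFinset_eq_degree, hdeg, cycleGraph_degree_three_le])
        have hv : v ∈ G.neighborFinset (f a) := by rwa [mem_neighborFinset]
        rw [← heq] at hv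
        obtain ⟨b, hb, rfl⟩ := mem_image.1 hv
        exact ⟨b, by rwa [mem_neighborFinset] at hb, rfl⟩
      have hadj : ∀ a b, G.Adj (f a) (f b) → (cycleGraph (m + 3)).Adj a b := by
        intro a b hab
        obtain ⟨c, hc, hcb⟩ := hnbr a _ hab
        rwa [f.injective hcb] at hc
      have hsurj : Function.Surjective f := by
        intro v
        obtain ⟨p⟩ := hG.preconnected (f 0) v
        have key : ∀ {x y : V}, G.Walk x y → (∃ a, f a = x) → ∃ a, f a = y := by
          intro x y p
          induction p with
          | nil => exact id
          | cons hxy _ ih =>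
            rintro ⟨a, rfl⟩
            obtain ⟨b, _, hb⟩ := hnbr a _ hxy
            exact ih ⟨b, hb⟩
        exact key p ⟨0, rfl⟩
      refine ⟨hadj, fun a b => ?_⟩
      let e : cycleGraph (m + 3) ≃g G :=
        ⟨Equiv.ofBijective f ⟨f.injective, hsurj⟩, fun {a b} =>
          ⟨fun h => hadj a b h, fun h => f.toHom.map_adj h⟩⟩
      have h1 := lapMatrix_submatrix_iso (R := ℝ) e
      have h2 := adjugate_submatrix_equiv_self e.toEquiv (G.lapMatrix ℝ)
      obtain ⟨a, rfl⟩ := e.surjective a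
      obtain ⟨b, rfl⟩ := e.surjective b
      rw [← adjugate_lapMatrix_cycleGraph m a b, ← h1]
      exact (congrFun (congrFun h2 a) b).symm

/-! ### Spectral facts on real symmetric matrices. -/

section Hermitian

variable {n : Type*} [Fintype n] [DecidableEq n]

theorem charpoly_eq_of_roots_eq {m : Type*} [Fintype m] [DecidableEq m] {A : Matrix n n ℝ}
    {B : Matrix m m ℝ} (hA : A.IsHermitian) (hB : B.IsHermitian)
    (h : A.charpoly.roots = B.charpoly.roots) : A.charpoly = B.charpoly := by
  rw [hA.splits_charpoly.eq_prod_roots_of_monic A.charpoly_monic,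
    hB.splits_charpoly.eq_prod_roots_of_monic B.charpoly_monic, h]

theorem trace_mul_self_eq_sum_roots {A : Matrix n n ℝ} (hA : A.IsHermitian) :
    (A * A).trace = (A.charpoly.roots.map (· ^ 2)).sum := by
  rw [hA.roots_charpoly_eq_eigenvalues]
  conv_lhs => rw [hA.spectral_theorem, ← map_mul, Unitary.conjStarAlgAut_apply, trace_mul_comm,
    ← mul_assoc]
  simp [trace_diagonal, diagonal_mul_diagonal, pow_two]

theorem quadratic_form_lt_of_roots_lt {A : Matrix n n ℝ} (hA : A.IsHermitian) {c : ℝ}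
    (h : ∀ r ∈ A.charpoly.roots, r < c) {x : n → ℝ} (hx : x ≠ 0) :
    x ⬝ᵥ (A *ᵥ x) < c * (x ⬝ᵥ x) := by
  have hB : (Matrix.scalar n c - A).IsHermitian := by
    refine IsHermitian.sub ?_ hA
    ext i j
    simp [diagonal_apply, eq_comm]
  have hpos : (Matrix.scalar n c - A).PosDef := by
    rw [hB.posDef_iff_eigenvalues_pos]
    intro i
    set r := hB.eigenvalues i
    have hr : r ∈ (Matrix.scalar n c - A).charpoly.roots := by
      rw [hB.roots_charpoly_eq_eigenvalues]
      exact Multiset.mem_map_of_mem _ (mem_univ i)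
    have hr' : c - r ∈ A.charpoly.roots := by
      rw [Polynomial.mem_roots (charpoly_monic _).ne_zero, Polynomial.IsRoot.def,
        eval_charpoly] at hr ⊢
      have : Matrix.scalar n (c - r) - A = -(Matrix.scalar n r - (Matrix.scalar n c - A)) := by
        rw [map_sub]; abel
      rw [this, det_neg, hr, mul_zero]
    linarith [h _ hr']
  have := hpos.dotProduct_mulVec_pos hx
  rw [sub_mulVec, star_trivial, dotProduct_sub] at this
  simp only [scalar_apply, mulVec_diagonal, dotProduct] at this ⊢
  rw [mul_sum]
  simp only [mul_left_comm c]
  linarith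

end Hermitian

/-! ### Eigenvalue bounds, traces and connectedness from the Laplacian. -/

section Bounds

variable {V : Type*} [Fintype V] [DecidableEq V] (G : SimpleGraph V) [DecidableRel G.Adj]

/-- A bound on the Laplacian eigenvalues from a positive test vector. -/
theorem lapSpectrum_lt_of_weight {w : V → ℝ} (hw : ∀ v, 0 < w v) {c : ℝ}
    (h : ∀ u, ∑ v ∈ G.neighborFinset u, (w u + w v) < c * w u) : ∀ r ∈ G.lapSpectrum, r < c := by
  intro r hr
  rw [lapSpectrum, Polynomial.mem_roots (charpoly_monic _).ne_zero, Polynomial.IsRoot.def,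
    eval_charpoly] at hr
  obtain ⟨x, hx0, hx⟩ := exists_mulVec_eq_zero_iff.2 hr
  obtain ⟨z, hz⟩ := Function.ne_iff.1 hx0
  have : Nonempty V := ⟨z⟩
  -- At a vertex maximizing `|x v| / w v`, the eigenvalue equation is bounded by the row inequality
  -- for `w`.
  obtain ⟨u, -, hu⟩ := exists_max_image univ (fun v => |x v| / w v) univ_nonempty
  set q := |x u| / w u
  have hq : 0 < q := lt_of_lt_of_le (div_pos (abs_pos.2 hz) (hw z)) (hu z (mem_univ z))
  have hle : ∀ v, |x v| ≤ q * w v := fun v => (div_le_iff₀ (hw v)).1 (hu v (mem_univ v))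
  have hxu : |x u| = q * w u := (div_eq_iff (hw u).ne').1 rfl
  have hrow : r * x u = ∑ v ∈ G.neighborFinset u, (x u - x v) := by
    have := congrFun hx u
    rw [sub_mulVec, Pi.sub_apply, lapMatrix_mulVec_apply, scalar_apply, mulVec_diagonal,
      Pi.zero_apply, sub_eq_zero] at this
    rw [this, sum_sub_distrib, sum_const, card_neighborFinset_eq_degree, nsmul_eq_mul]
  have h1 : |r| * (q * w u) < c * (q * w u) :=
    calc |r| * (q * w u) = |r * x u| := by rw [abs_mul, hxu]
      _ ≤ ∑ v ∈ G.neighborFinset u, |x u - x v| := by rw [hrow]; exact abs_sum_le_sum_abs _ _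
      _ ≤ ∑ v ∈ G.neighborFinset u, q * (w u + w v) := by
        refine sum_le_sum fun v _ => (abs_sub _ _).trans ?_
        rw [mul_add]
        exact add_le_add (hle u) (hle v)
      _ = q * ∑ v ∈ G.neighborFinset u, (w u + w v) := by rw [mul_sum]
      _ < q * (c * w u) := mul_lt_mul_of_pos_left (h u) hq
      _ = c * (q * w u) := by ring
  exact lt_of_le_of_lt (le_abs_self r) (lt_of_mul_lt_mul_right h1 (mul_pos hq (hw u)).le)

/-- A vertex of degree `d ≥ 1` forces a Laplacian eigenvalue of size at least `d + 1`. -/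
theorem degree_add_one_lt_of_lapSpectrum_lt {c : ℝ} (h : ∀ r ∈ G.lapSpectrum, r < c) {v : V}
    (hv : 0 < G.degree v) : (G.degree v : ℝ) + 1 < c := by
  set d : ℝ := (G.degree v : ℝ) with hd
  have hd0 : 0 < d := by rw [hd]; exact_mod_cast hv
  -- The top eigenvector of a star with centre `v`. Its Rayleigh quotient in `G` is at least `d (d +
  -- 1) ^ 2 / (d ^ 2 + d) = d + 1`.
  set x : V → ℝ := fun u => if u = v then d else if G.Adj v u then -1 else 0 with hx
  have hxv : x v = d := if_pos rfl
  have hsum : ∑ u, (if G.Adj v u then (1 : ℝ) else 0) = d := by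
    rw [hd, degree_eq_sum_if_adj]
  have hx0 : x ≠ 0 := fun h0 => hd0.ne' (by rw [← hxv, h0]; rfl)
  have hlt := quadratic_form_lt_of_roots_lt (G.isHermitian_lapMatrix (R := ℝ)) h hx0
  have hnorm : x ⬝ᵥ x = d ^ 2 + d := by
    have : ∀ u, x u * x u = (if u = v then d ^ 2 else 0) + if G.Adj v u then (1 : ℝ) else 0 := by
      intro u
      by_cases huv : u = v
      · subst huv; simp [hx, pow_two]
      · by_cases ha : G.Adj v u <;> simp [hx, huv, ha]
    simp only [dotProduct, this, sum_add_distrib, hsum]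
    simp
  have hform : x ⬝ᵥ (G.lapMatrix ℝ *ᵥ x)
      = (∑ i, ∑ j, if G.Adj i j then (x i - x j) ^ 2 else 0) / 2 := by
    rw [← lapMatrix_toLinearMap₂', toLinearMap₂'_apply']
  have hge : d * (d + 1) ^ 2 ≤ x ⬝ᵥ (G.lapMatrix ℝ *ᵥ x) := by
    have hrowv : ∑ j, (if G.Adj v j then (x v - x j) ^ 2 else 0) = d * (d + 1) ^ 2 := by
      rw [← hsum, sum_mul]
      refine sum_congr rfl fun j _ => ?_
      by_cases ha : G.Adj v j
      · have : j ≠ v := ha.ne'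
        simp only [if_pos ha, hx, if_neg this, if_true, hsum]
        ring
      · simp [ha]
    have hcol : ∀ i ∈ univ.erase v, (if G.Adj v i then (x v - x i) ^ 2 else 0)
        ≤ ∑ j, if G.Adj i j then (x i - x j) ^ 2 else 0 := by
      intro i _
      have h1 := single_le_sum (f := fun j => if G.Adj i j then (x i - x j) ^ 2 else 0)
        (fun j _ => by positivity) (mem_univ v)
      refine le_trans (le_of_eq ?_) h1
      simp only [G.adj_comm i v, ← neg_sub (x v) (x i), neg_sq]
    have h2 := sum_le_sum hcol
    have h3 := add_sum_erase univ (fun j => if G.Adj v j then (x v - x j) ^ 2 else 0) (mem_univ v)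
    have h4 := add_sum_erase univ
      (fun i => ∑ j, if G.Adj i j then (x i - x j) ^ 2 else 0) (mem_univ v)
    simp only [SimpleGraph.irrefl, if_false, zero_add] at h3
    rw [hform, ← h4, hrowv]
    rw [h3, hrowv] at h2
    linarith
  rw [hnorm] at hlt
  have h5 : (d * (d + 1)) * (d + 1) < (d * (d + 1)) * c := by nlinarith
  exact lt_of_mul_lt_mul_left h5 (by positivity)

theorem trace_lapMatrix : (G.lapMatrix ℝ).trace = ∑ v, (G.degree v : ℝ) := by
  simp [trace, lapMatrix_apply]

theorem trace_lapMatrix_mul_self :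
    (G.lapMatrix ℝ * G.lapMatrix ℝ).trace = ∑ v, ((G.degree v : ℝ) ^ 2 + G.degree v) := by
  simp only [trace, diag_apply, mul_apply]
  refine sum_congr rfl fun v _ => ?_
  have : ∀ u, G.lapMatrix ℝ v u * G.lapMatrix ℝ u v
      = (if u = v then (G.degree v : ℝ) ^ 2 else 0) + if G.Adj v u then 1 else 0 := by
    intro u
    rw [lapMatrix_apply, lapMatrix_apply]
    by_cases huv : u = v
    · subst huv; simp [pow_two]
    · by_cases ha : G.Adj v u <;> simp [huv, Ne.symm huv, G.adj_comm u v, ha]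
  rw [sum_congr rfl fun u _ => this u, sum_add_distrib, degree_eq_sum_if_adj]
  simp

/-- A graph is connected if its Laplacian becomes nonsingular after adding the all-ones matrix. -/
theorem connected_of_det_lapMatrix_add_one_ne_zero [Nonempty V]
    (h : (G.lapMatrix ℝ + Matrix.of fun _ _ => 1).det ≠ 0) : G.Connected := by
  classical
  refine ⟨fun a b => ?_⟩
  by_contra hab
  set n : ℝ := (Fintype.card V : ℝ)
  set s : ℝ := ∑ v, if G.Reachable a v then 1 else 0 with hs
  -- The indicator of the component of `a`, scaled and shifted to have sum zero. Both `L` and the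
  -- all-ones matrix annihilate it.
  set x : V → ℝ := fun v => n * (if G.Reachable a v then 1 else 0) - s with hx
  refine h (exists_mulVec_eq_zero_iff.1 ⟨x, fun h0 => ?_, ?_⟩)
  · have h1 := congrFun h0 a
    have h2 := congrFun h0 b
    have hn : n ≠ 0 := Nat.cast_ne_zero.2 Fintype.card_ne_zero
    simp [hx, hab] at h1 h2
    rw [h2, sub_zero] at h1
    exact hn h1
  · rw [add_mulVec, G.lapMatrix_mulVec_eq_zero_iff_forall_reachable.2, zero_add]
    · ext i
      simp only [mulVec, dotProduct, of_apply, one_mul, hx, sum_sub_distrib, ← mul_sum, ← hs]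
      simp [n]
    · intro i j hij
      simp only [hx, (show G.Reachable a i ↔ G.Reachable a j from
        ⟨fun h => h.trans hij, fun h => h.trans hij.symm⟩)]

end Bounds

/-! ### Invariants determined by the Laplacian spectrum. -/

section Cospectral

variable {V : Type u} [Fintype V] [DecidableEq V] {G : SimpleGraph V} [DecidableRel G.Adj]
  {W : Type v} [Fintype W] [DecidableEq W] {H : SimpleGraph W} [DecidableRel H.Adj]

theorem charpoly_lapMatrix_eq (h : H.lapSpectrum = G.lapSpectrum) :
    (H.lapMatrix ℝ).charpoly = (G.lapMatrix ℝ).charpoly :=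
  charpoly_eq_of_roots_eq (H.isHermitian_lapMatrix (R := ℝ)) (G.isHermitian_lapMatrix (R := ℝ)) h

theorem card_eq_of_lapSpectrum_eq (h : H.lapSpectrum = G.lapSpectrum) :
    Fintype.card W = Fintype.card V := by
  rw [← (H.lapMatrix ℝ).charpoly_natDegree_eq_dim, charpoly_lapMatrix_eq h,
    charpoly_natDegree_eq_dim]

theorem sum_degree_eq_of_lapSpectrum_eq (h : H.lapSpectrum = G.lapSpectrum) :
    ∑ v, H.degree v = ∑ v, G.degree v := by
  have := trace_eq_neg_charpoly_nextCoeff (H.lapMatrix ℝ)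
  rw [charpoly_lapMatrix_eq h, ← trace_eq_neg_charpoly_nextCoeff, trace_lapMatrix,
    trace_lapMatrix] at this
  exact_mod_cast this

theorem sum_degree_sq_eq_of_lapSpectrum_eq (h : H.lapSpectrum = G.lapSpectrum) :
    ∑ v, H.degree v ^ 2 = ∑ v, G.degree v ^ 2 := by
  have h1 := trace_mul_self_eq_sum_roots (H.isHermitian_lapMatrix (R := ℝ))
  have h2 := trace_mul_self_eq_sum_roots (G.isHermitian_lapMatrix (R := ℝ))
  rw [charpoly_lapMatrix_eq h, ← h2, trace_lapMatrix_mul_self, trace_lapMatrix_mul_self,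
    sum_add_distrib, sum_add_distrib] at h1
  have h3 : (∑ v, (H.degree v : ℝ)) = ∑ v, (G.degree v : ℝ) := by
    exact_mod_cast sum_degree_eq_of_lapSpectrum_eq h
  rw [h3, add_left_inj] at h1
  exact_mod_cast h1

/-- Since `L J = 0`, one has `(X - L) (X - J) = X (X - L - J)`. Hence the characteristic polynomial
of `L + J` depends only on that of `L` and on the number of vertices. -/
theorem charpoly_lapMatrix_add_one :
    (G.lapMatrix ℝ).charpoly * (Matrix.of fun _ _ => 1 : Matrix V V ℝ).charpoly
      = Polynomial.X ^ Fintype.card V * (G.lapMatrix ℝ + Matrix.of fun _ _ => 1).charpoly := by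
  have h0 : G.lapMatrix ℝ * (Matrix.of fun _ _ => 1 : Matrix V V ℝ) = 0 := by
    ext i j
    have := congrFun (G.lapMatrix_mulVec_const_eq_zero (R := ℝ)) i
    simpa [mul_apply, mulVec, dotProduct] using this
  rw [charpoly, charpoly, charpoly, ← det_mul, ← det_smul]
  congr 1
  simp only [charmatrix, map_add, sub_mul, mul_sub, ← map_mul, h0, map_zero, sub_zero]
  simp only [scalar_apply, ← smul_one_eq_diagonal, smul_mul_assoc, one_mul, mul_smul_comm, mul_one,
    smul_sub, smul_add, mul_smul]
  abel

theorem det_lapMatrix_add_one_eq_of_lapSpectrum_eq (h : H.lapSpectrum = G.lapSpectrum) :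
    (H.lapMatrix ℝ + Matrix.of fun _ _ => 1).det = (G.lapMatrix ℝ + Matrix.of fun _ _ => 1).det := by
  have hcard := card_eq_of_lapSpectrum_eq h
  have h1 := charpoly_lapMatrix_add_one (G := H)
  have h2 := charpoly_lapMatrix_add_one (G := G)
  have h3 : (Matrix.of fun _ _ => 1 : Matrix W W ℝ).charpoly
      = (Matrix.of fun _ _ => 1 : Matrix V V ℝ).charpoly := by
    rw [← charpoly_reindex (Fintype.equivOfCardEq hcard)]
    rfl
  rw [charpoly_lapMatrix_eq h, h3, h2, hcard] at h1
  have h4 := mul_left_cancel₀ (pow_ne_zero _ Polynomial.X_ne_zero) h1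
  rw [det_eq_sign_charpoly_coeff, det_eq_sign_charpoly_coeff, ← h4, hcard]

theorem charpoly_lapMatrix_int_eq (h : H.lapSpectrum = G.lapSpectrum) :
    (H.lapMatrix ℤ).charpoly = (G.lapMatrix ℤ).charpoly := by
  refine Polynomial.map_injective (Int.castRingHom ℝ) Int.cast_injective ?_
  rw [← charpoly_map, ← charpoly_map, map_lapMatrix, map_lapMatrix, charpoly_lapMatrix_eq h]

/-- Over a field `s + t L = -t (-(s / t) - L)`. Using the integer characteristic polynomial allows
equality of real spectra to be transferred to any domain. -/
theorem algebraMap_det_homogeneous (G : SimpleGraph V) [DecidableRel G.Adj] {R K : Type*}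
    [CommRing R] [Field K] (f : R →+* K) (s t : R) (ht : f t ≠ 0) :
    f (s • (1 : Matrix V V R) + t • G.lapMatrix R).det
      = (-f t) ^ Fintype.card V * (((G.lapMatrix ℤ).charpoly).map (Int.castRingHom K)).eval
        (-(f s / f t)) := by
  rw [← charpoly_map, map_lapMatrix, eval_charpoly, ← det_smul, RingHom.map_det]
  congr 1
  rw [RingHom.mapMatrix_apply, ← map_lapMatrix G f]
  ext i j
  simp only [Matrix.map_apply, Matrix.add_apply, Matrix.smul_apply, Matrix.sub_apply, smul_eq_mul,
    map_add, map_mul, scalar_apply, diagonal_apply, one_apply]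
  split_ifs
  · rw [map_one, mul_sub, neg_mul_neg, mul_div_cancel₀ _ ht]
    ring
  · rw [map_zero]
    ring

/-- Homogenized form of the equality of characteristic polynomials. -/
theorem det_homogeneous_eq_of_lapSpectrum_eq (h : H.lapSpectrum = G.lapSpectrum) {R : Type*}
    [CommRing R] [IsDomain R] (s t : R) (ht : t ≠ 0) :
    (s • (1 : Matrix W W R) + t • H.lapMatrix R).det
      = (s • (1 : Matrix V V R) + t • G.lapMatrix R).det := by
  have hft : algebraMap R (FractionRing R) t ≠ 0 := by simpa using ht
  refine IsFractionRing.injective R (FractionRing R) ?_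
  rw [algebraMap_det_homogeneous H _ s t hft, algebraMap_det_homogeneous G _ s t hft,
    card_eq_of_lapSpectrum_eq h, charpoly_lapMatrix_int_eq h]

end Cospectral

/-! ### Cycles with attached leaves and their degree sums. -/

/-- The cycle on `Fin ℓ` with `i a` leaves attached to the vertex `a`. -/
def sunGraph {ℓ : ℕ} (i : Fin ℓ → ℕ) : SimpleGraph (Fin ℓ ⊕ Σ a, Fin (i a)) where
  Adj x y := match x, y with
    | .inl a, .inl b => (cycleGraph ℓ).Adj a b
    | .inl a, .inr p => a = p.1
    | .inr p, .inl a => a = p.1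
    | .inr _, .inr _ => False
  symm := ⟨by
    rintro (a | p) (b | q) h
    · exact Adj.symm (G := cycleGraph ℓ) h
    · exact h
    · exact h
    · exact h⟩
  loopless := ⟨by
    rintro (a | p) h
    · exact (cycleGraph ℓ).irrefl h
    · exact h⟩

section Sun

variable {ℓ : ℕ} (i : Fin ℓ → ℕ)

@[simp] theorem sunGraph_adj_inl_inl (a b : Fin ℓ) :
    (sunGraph i).Adj (.inl a) (.inl b) ↔ (cycleGraph ℓ).Adj a b := Iff.rfl

@[simp] theorem sunGraph_adj_inl_inr (a : Fin ℓ) (p : Σ a, Fin (i a)) :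
    (sunGraph i).Adj (.inl a) (.inr p) ↔ a = p.1 := Iff.rfl

@[simp] theorem sunGraph_adj_inr_inl (a : Fin ℓ) (p : Σ a, Fin (i a)) :
    (sunGraph i).Adj (.inr p) (.inl a) ↔ a = p.1 := Iff.rfl

@[simp] theorem sunGraph_adj_inr_inr (p q : Σ a, Fin (i a)) :
    (sunGraph i).Adj (.inr p) (.inr q) ↔ False := Iff.rfl

instance : DecidableRel (sunGraph i).Adj
  | .inl a, .inl b => inferInstanceAs (Decidable ((cycleGraph ℓ).Adj a b))
  | .inl a, .inr p => inferInstanceAs (Decidable (a = p.1))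
  | .inr p, .inl a => inferInstanceAs (Decidable (a = p.1))
  | .inr _, .inr _ => inferInstanceAs (Decidable False)

theorem sum_neighborFinset_sunGraph_inl {M : Type*} [AddCommMonoid M] (a : Fin ℓ)
    (f : (Fin ℓ ⊕ Σ a, Fin (i a)) → M) :
    ∑ v ∈ (sunGraph i).neighborFinset (.inl a), f v
      = ∑ b ∈ (cycleGraph ℓ).neighborFinset a, f (.inl b) + ∑ x : Fin (i a), f (.inr ⟨a, x⟩) := by
  rw [neighborFinset_eq_filter, neighborFinset_eq_filter, sum_filter, sum_filter,
    Fintype.sum_sum_type, Fintype.sum_sigma]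
  simp only [sunGraph_adj_inl_inl, sunGraph_adj_inl_inr]
  congr 1
  rw [Fintype.sum_eq_single a]
  · simp
  · intro b hb
    simp [hb.symm]

theorem sum_neighborFinset_sunGraph_inr {M : Type*} [AddCommMonoid M] (p : Σ a, Fin (i a))
    (f : (Fin ℓ ⊕ Σ a, Fin (i a)) → M) :
    ∑ v ∈ (sunGraph i).neighborFinset (.inr p), f v = f (.inl p.1) := by
  rw [neighborFinset_eq_filter, sum_filter, Fintype.sum_sum_type, Fintype.sum_sigma]
  simp

theorem degree_sunGraph_inl {m : ℕ} (i : Fin (m + 3) → ℕ) (a : Fin (m + 3)) :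
    (sunGraph i).degree (.inl a) = 2 + i a := by
  rw [← card_neighborFinset_eq_degree, card_eq_sum_ones, sum_neighborFinset_sunGraph_inl,
    ← card_eq_sum_ones, card_neighborFinset_eq_degree, cycleGraph_degree_three_le]
  simp

theorem degree_sunGraph_inr (p : Σ a, Fin (i a)) :
    (sunGraph i).degree (.inr p) = 1 := by
  rw [← card_neighborFinset_eq_degree, card_eq_sum_ones, sum_neighborFinset_sunGraph_inr]

theorem card_sunGraph : Fintype.card (Fin ℓ ⊕ Σ a, Fin (i a)) = ℓ + ∑ a, i a := by
  simp

theorem sum_degree_sunGraph {m : ℕ} (i : Fin (m + 3) → ℕ) :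
    ∑ v, (sunGraph i).degree v = 2 * (m + 3) + 2 * ∑ a, i a := by
  simp only [Fintype.sum_sum_type, Fintype.sum_sigma, degree_sunGraph_inl, degree_sunGraph_inr,
    sum_add_distrib]
  simp
  ring

theorem sum_degree_sq_sunGraph {m : ℕ} (i : Fin (m + 3) → ℕ) :
    ∑ v, (sunGraph i).degree v ^ 2 = 4 * (m + 3) + 5 * ∑ a, i a + ∑ a, i a ^ 2 := by
  simp only [Fintype.sum_sum_type, Fintype.sum_sigma, degree_sunGraph_inl, degree_sunGraph_inr,
    add_sq, sum_add_distrib, ← mul_sum]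
  simp
  ring

end Sun

/-! ### Recognizing sun graphs. -/

section Structure

variable {V : Type*} [Fintype V] {G : SimpleGraph V} [DecidableRel G.Adj]

theorem degree_eq_two_add_card_leaves {m : ℕ} (c : cycleGraph (m + 3) ↪g G)
    (hc : Set.range c = G.core) (a : Fin (m + 3)) :
    G.degree (c a) = 2 + Fintype.card {u // G.degree u = 1 ∧ G.Adj (c a) u} := by
  have h1 : (G.neighborFinset (c a)).filter (fun u => ¬ G.degree u = 1)
      = ((cycleGraph (m + 3)).neighborFinset a).map c.toEmbedding := by
    ext u
    simp only [mem_filter, mem_neighborFinset, mem_map]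
    constructor
    · rintro ⟨hu, hd⟩
      obtain ⟨b, rfl⟩ : u ∈ Set.range c := by rw [hc]; exact hd
      exact ⟨b, c.map_adj_iff.1 hu, rfl⟩
    · rintro ⟨b, hb, rfl⟩
      refine ⟨c.map_adj_iff.2 hb, ?_⟩
      have : c b ∈ G.core := by rw [← hc]; exact ⟨b, rfl⟩
      exact this
  rw [← card_neighborFinset_eq_degree,
    ← card_filter_add_card_filter_not (s := G.neighborFinset (c a)) (fun u => G.degree u = 1), h1,
    card_map, card_neighborFinset_eq_degree, cycleGraph_degree_three_le, add_comm,
    Fintype.card_subtype]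
  congr 2
  ext u
  simp [and_comm]

/-- A connected graph whose vertices of degree different from `1` induce a cycle is isomorphic to
a cycle with leaves attached. -/
theorem nonempty_iso_sunGraph (hG : G.Connected) {m : ℕ} (c : cycleGraph (m + 3) ↪g G)
    (hc : Set.range c = G.core) :
    Nonempty (sunGraph (fun a => G.degree (c a) - 2) ≃g G) := by
  have hcore : ∀ a, G.degree (c a) ≠ 1 := by
    intro a
    have : c a ∈ G.core := by rw [← hc]; exact ⟨a, rfl⟩
    exact this
  have hcard : ∀ a, Fintype.card (Fin (G.degree (c a) - 2))
      = Fintype.card {u // G.degree u = 1 ∧ G.Adj (c a) u} := by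
    intro a
    rw [Fintype.card_fin, degree_eq_two_add_card_leaves c hc, Nat.add_sub_cancel_left]
  let e := fun a => Fintype.equivOfCardEq (hcard a)
  have hcs : ∀ u, G.degree u ≠ 1 → ∃ a, c a = u := by
    intro u hu
    have : u ∈ Set.range c := by rw [hc]; exact hu
    exact this
  have hleaf : ∀ u, G.degree u = 1 → ∃ a, G.Adj (c a) u := by
    intro u hu
    obtain ⟨w, huw, hw⟩ := degree_eq_one_iff_existsUnique_adj.1 hu
    -- Two adjacent leaves would form a whole component, leaving no room for the cycle.
    by_cases hd : G.degree w = 1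
    · exfalso
      obtain ⟨x, _, hx⟩ := degree_eq_one_iff_existsUnique_adj.1 hd
      have key : ∀ {y z : V}, G.Walk y z → (y = u ∨ y = w) → (z = u ∨ z = w) := by
        intro y z p
        induction p with
        | nil => exact id
        | cons hyz _ ih =>
          rintro (rfl | rfl)
          · exact ih (Or.inr (hw _ hyz))
          · exact ih (Or.inl ((hx _ hyz).trans (hx _ huw.symm).symm))
      obtain ⟨p⟩ := hG.preconnected u (c 0)
      rcases key p (Or.inl rfl) with h | h
      · exact hcore 0 (h ▸ hu)
      · exact hcore 0 (h ▸ hd)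
    · obtain ⟨a, rfl⟩ := hcs w hd
      exact ⟨a, huw.symm⟩
  have huniq : ∀ u, G.degree u = 1 → ∀ x y, G.Adj x u → G.Adj y u → x = y := by
    intro u hu x y hx hy
    obtain ⟨w, _, hw⟩ := degree_eq_one_iff_existsUnique_adj.1 hu
    rw [hw x hx.symm, hw y hy.symm]
  let g : (Fin (m + 3) ⊕ Σ a, Fin (G.degree (c a) - 2)) → V :=
    Sum.elim c (fun p => (e p.1 p.2 : V))
  have hinj : Function.Injective g := by
    rintro (a | ⟨a, x⟩) (b | ⟨b, y⟩) hab
    · exact congrArg _ (c.injective hab)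
    · have hab' : c a = (e b y : V) := hab
      exact absurd (hab' ▸ (e b y).2.1) (hcore a)
    · have hab' : (e a x : V) = c b := hab
      exact absurd (hab' ▸ (e a x).2.1) (hcore b)
    · have hab' : (e a x : V) = e b y := hab
      obtain rfl : a = b := c.injective
        (huniq _ (e a x).2.1 _ _ (e a x).2.2 (hab' ▸ (e b y).2.2))
      rw [(e a).injective (Subtype.ext hab')]
  have hsurj : Function.Surjective g := by
    intro u
    by_cases hu : G.degree u = 1
    · obtain ⟨a, ha⟩ := hleaf u hu
      exact ⟨.inr ⟨a, (e a).symm ⟨u, hu, ha⟩⟩, by simp [g]⟩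
    · obtain ⟨a, rfl⟩ := hcs u hu
      exact ⟨.inl a, rfl⟩
  refine ⟨⟨Equiv.ofBijective g ⟨hinj, hsurj⟩, ?_⟩⟩
  have hcl : ∀ (a : Fin (m + 3)) (p : Σ a, Fin (G.degree (c a) - 2)),
      G.Adj (c a) (e p.1 p.2) ↔ a = p.1 := by
    intro a p
    constructor
    · intro h
      exact c.injective (huniq _ (e p.1 p.2).2.1 _ _ h (e p.1 p.2).2.2)
    · rintro rfl
      exact (e _ _).2.2
  rintro (a | p) (b | q)
  · exact c.map_adj_iff
  · exact hcl a q
  · exact (G.adj_comm _ _).trans (hcl b p)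
  · refine ⟨fun h => ?_, fun h => h.elim⟩
    have h' : G.Adj (e p.1 p.2 : V) (e q.1 q.2) := h
    have := huniq _ (e q.1 q.2).2.1 _ _ h' (e q.1 q.2).2.2
    exact hcore q.1 (this ▸ (e p.1 p.2).2.1)

end Structure

/-! ### Cycle length and hub counts from the spectrum. -/

theorem lapSpectrum_eq_of_iso {V W : Type*} [Fintype V] [DecidableEq V] [Fintype W]
    [DecidableEq W] {G : SimpleGraph V} {H : SimpleGraph W} [DecidableRel G.Adj]
    [DecidableRel H.Adj] (e : G ≃g H) : G.lapSpectrum = H.lapSpectrum := by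
  rw [lapSpectrum, lapSpectrum, ← lapMatrix_submatrix_iso (R := ℝ) e,
    ← charpoly_reindex e.symm.toEquiv (H.lapMatrix ℝ)]
  rfl

/-- Exactly one vertex carries one leaf, `k` vertices carry two, and the others carry none. -/
structure HubCounts {ℓ : ℕ} (k : ℕ) (i : Fin ℓ → ℕ) : Prop where
  le_two : ∀ a, i a ≤ 2
  card_one : #{a | i a = 1} = 1
  card_two : #{a | i a = 2} = k

/-- Used to see that factors of the determinant taken over all cycle vertices depend on the counts
alone, hence cancel between cospectral graphs. -/
theorem HubCounts.prod_eq {ℓ k : ℕ} {i : Fin ℓ → ℕ} (h : HubCounts k i) {M : Type*}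
    [CommMonoid M] (g : ℕ → M) (hg : g 0 = 1) : ∏ a, g (i a) = g 1 * g 2 ^ k := by
  have : ∀ a, g (i a) = (if i a = 1 then g 1 else 1) * if i a = 2 then g 2 else 1 := by
    intro a
    have := h.le_two a
    interval_cases i a <;> simp [hg]
  rw [prod_congr rfl fun a _ => this a, prod_mul_distrib, ← prod_filter, ← prod_filter, prod_const,
    prod_const, h.card_one, h.card_two, pow_one]

theorem HubCounts.sum_eq {ℓ k : ℕ} {i : Fin ℓ → ℕ} (h : HubCounts k i) (g : ℕ → ℕ)
    (hg : g 0 = 0) : ∑ a, g (i a) = g 1 + k * g 2 := by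
  have := h.prod_eq (M := Multiplicative ℕ) (fun n => .ofAdd (g n)) (by rw [hg]; rfl)
  rw [← ofAdd_sum, ← ofAdd_nsmul, ← ofAdd_add] at this
  exact Multiplicative.ofAdd.injective this

/-- If no two hubs are adjacent then the Laplacian eigenvalues are less than `6`. -/
theorem lapSpectrum_sunGraph_lt_six {m k : ℕ} {i : Fin (m + 3) → ℕ} (hi : HubCounts k i)
    (hadj : ∀ a b, (cycleGraph (m + 3)).Adj a b → i a = 0 ∨ i b = 0) :
    ∀ r ∈ (sunGraph i).lapSpectrum, r < 6 := by
  refine lapSpectrum_lt_of_weight (sunGraph i)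
    -- The row inequalities become `2 * 28 < 60` at a vertex without leaves (each neighbour weighs
    -- at most `18`), `2 * 28 + 2 * 23 < 108` at a 2-hub and `5 + 18 < 30` at a leaf.
    (w := Sum.elim (fun a => if i a = 0 then 10 else 18) (fun _ => 5)) ?_ ?_
  · rintro (a | p)
    · simp only [Sum.elim_inl]; split_ifs <;> norm_num
    · simp
  · rintro (a | p)
    · rw [sum_neighborFinset_sunGraph_inl]
      simp only [Sum.elim_inl, Sum.elim_inr, sum_const, card_univ, Fintype.card_fin, nsmul_eq_mul]
      have h2 := hi.le_two a
      by_cases ha : i a = 0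
      · have : ∑ b ∈ (cycleGraph (m + 3)).neighborFinset a,
            ((if i a = 0 then (10 : ℝ) else 18) + if i b = 0 then 10 else 18)
            ≤ ∑ b ∈ (cycleGraph (m + 3)).neighborFinset a, 28 := by
          refine sum_le_sum fun b _ => ?_
          rw [if_pos ha]; split_ifs <;> norm_num
        rw [sum_const, card_neighborFinset_eq_degree, cycleGraph_degree_three_le] at this
        rw [ha] at this ⊢
        norm_num at this ⊢
        linarith
      · have : ∑ b ∈ (cycleGraph (m + 3)).neighborFinset a,
            ((if i a = 0 then (10 : ℝ) else 18) + if i b = 0 then 10 else 18)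
            = ∑ b ∈ (cycleGraph (m + 3)).neighborFinset a, 28 := by
          refine sum_congr rfl fun b hb => ?_
          rw [mem_neighborFinset] at hb
          rw [if_neg ha, if_pos ((hadj a b hb).resolve_left ha)]; norm_num
        rw [this, sum_const, card_neighborFinset_eq_degree, cycleGraph_degree_three_le, if_neg ha]
        have h2' : (i a : ℝ) ≤ 2 := by exact_mod_cast h2
        norm_num
        linarith
    · rw [sum_neighborFinset_sunGraph_inr]
      simp only [Sum.elim_inl, Sum.elim_inr]
      split_ifs <;> norm_num

theorem connected_sunGraph {m : ℕ} (i : Fin (m + 3) → ℕ) : (sunGraph i).Connected := by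
  let f : cycleGraph (m + 3) →g sunGraph i := ⟨Sum.inl, fun h => h⟩
  have h0 : ∀ x, (sunGraph i).Reachable (.inl 0) x := by
    have hl : ∀ a, (sunGraph i).Reachable (.inl 0) (.inl a) := fun a =>
      (cycleGraph_preconnected 0 a).map f
    rintro (a | p)
    · exact hl a
    · exact (hl p.1).trans (Adj.reachable ((sunGraph_adj_inl_inr i p.1 p).2 rfl))
  exact ⟨fun x y => (h0 x).symm.trans (h0 y)⟩

theorem card_edgeFinset_sunGraph {m : ℕ} (i : Fin (m + 3) → ℕ) :
    #(sunGraph i).edgeFinset = Fintype.card (Fin (m + 3) ⊕ Σ a, Fin (i a)) := by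
  have := (sunGraph i).sum_degrees_eq_twice_card_edges
  rw [sum_degree_sunGraph] at this
  rw [card_sunGraph]
  omega

theorem det_lapMatrix_sunGraph_add_one {m : ℕ} (i : Fin (m + 3) → ℕ) :
    ((sunGraph i).lapMatrix ℝ + Matrix.of fun _ _ => 1).det
      = (Fintype.card (Fin (m + 3) ⊕ Σ a, Fin (i a)) : ℝ) ^ 2 * (m + 3 : ℕ) := by
  let f : Copy (cycleGraph (m + 3)) (sunGraph i) := ⟨⟨Sum.inl, fun h => h⟩, Sum.inl_injective⟩
  exact det_lapMatrix_add_one _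
    (unicyclic_copy (connected_sunGraph i) (card_edgeFinset_sunGraph i) f).2

theorem sum_comp_eq_of_mem_Icc {V : Type*} [Fintype V] (d : V → ℕ) (hd : ∀ v, 1 ≤ d v ∧ d v ≤ 4)
    (g : ℕ → ℕ) :
    ∑ v, g (d v) = #{v | d v = 1} * g 1 + #{v | d v = 2} * g 2 + #{v | d v = 3} * g 3
      + #{v | d v = 4} * g 4 := by
  have : ∀ v, g (d v) = (if d v = 1 then g 1 else 0) + (if d v = 2 then g 2 else 0)
      + (if d v = 3 then g 3 else 0) + if d v = 4 then g 4 else 0 := by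
    intro v
    obtain ⟨h1, h2⟩ := hd v
    interval_cases d v <;> simp
  rw [sum_congr rfl fun v _ => this v]
  simp only [sum_add_distrib, ← sum_filter, sum_const, smul_eq_mul]

/-- Graphs which are cospectral to a sparse sun graph are sun graphs with the same number of hubs
of each kind. -/
theorem exists_sunGraph_iso_of_lapSpectrum_eq {m k : ℕ} {i : Fin (m + 3) → ℕ}
    (hi : HubCounts k i) (hadj : ∀ a b, (cycleGraph (m + 3)).Adj a b → i a = 0 ∨ i b = 0)
    {W : Type v} [Fintype W] [DecidableEq W] {H : SimpleGraph W} [DecidableRel H.Adj]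
    (h : H.lapSpectrum = (sunGraph i).lapSpectrum) :
    ∃ j : Fin (m + 3) → ℕ, HubCounts k j ∧ Nonempty (sunGraph j ≃g H) := by
  have hs1 : ∑ a, i a = 2 * k + 1 := by
    rw [hi.sum_eq (fun n => n) rfl]; ring
  have hs2 : ∑ a, i a ^ 2 = 4 * k + 1 := by
    rw [hi.sum_eq (fun n => n ^ 2) rfl]; ring
  have hcard := card_eq_of_lapSpectrum_eq h
  have hcardW : Fintype.card W = m + 3 + (2 * k + 1) := by rw [hcard, card_sunGraph, hs1]
  have hne : Nonempty W := Fintype.card_pos_iff.1 (by omega)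
  have hdeg1 := sum_degree_eq_of_lapSpectrum_eq h
  have hdeg2 := sum_degree_sq_eq_of_lapSpectrum_eq h
  rw [sum_degree_sunGraph, hs1] at hdeg1
  rw [sum_degree_sq_sunGraph, hs1, hs2] at hdeg2
  have hdet := det_lapMatrix_add_one_eq_of_lapSpectrum_eq h
  rw [det_lapMatrix_sunGraph_add_one, ← hcard] at hdet
  have hW0 : (Fintype.card W : ℝ) ^ 2 ≠ 0 := pow_ne_zero _ (Nat.cast_ne_zero.2 (by omega))
  have hconn : H.Connected := by
    refine H.connected_of_det_lapMatrix_add_one_ne_zero ?_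
    rw [hdet]
    exact mul_ne_zero hW0 (Nat.cast_ne_zero.2 (by omega))
  have hE : #H.edgeFinset = Fintype.card W := by
    have := H.sum_degrees_eq_twice_card_edges
    omega
  obtain ⟨m', ⟨f'⟩⟩ := exists_copy_cycleGraph hconn hE
  obtain ⟨hemb', hadjg⟩ := unicyclic_copy hconn hE f'
  rw [det_lapMatrix_add_one _ hadjg] at hdet
  -- The common cofactor equals the cycle length, so `det (L + J)` determines it.
  obtain rfl : m' = m := by
    have := mul_left_cancel₀ hW0 hdet
    have := Nat.cast_injective this
    omega
  let f : cycleGraph (m' + 3) ↪g H :=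
    ⟨⟨f', f'.injective⟩, fun {a b} => ⟨fun h => hemb' a b h, fun h => f'.toHom.map_adj h⟩⟩
  have hf2 : ∀ a, 2 ≤ H.degree (f a) := fun a => two_le_degree_of_copy f' a
  have hnt : Nontrivial W := f.injective.nontrivial
  have hpos : ∀ v, 1 ≤ H.degree v := fun v => hconn.preconnected.degree_pos_of_nontrivial v
  have hle : ∀ v, H.degree v ≤ 4 := by
    intro v
    have h6 : ∀ r ∈ H.lapSpectrum, r < 6 := by
      rw [h]; exact lapSpectrum_sunGraph_lt_six hi hadj
    have := H.degree_add_one_lt_of_lapSpectrum_lt h6 (hpos v)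
    have h5 : H.degree v + 1 < 6 := by exact_mod_cast this
    omega
  have hd : ∀ v, 1 ≤ H.degree v ∧ H.degree v ≤ 4 := fun v => ⟨hpos v, hle v⟩
  have e0 := sum_comp_eq_of_mem_Icc _ hd (fun _ => 1)
  have e1 := sum_comp_eq_of_mem_Icc _ hd (fun n => n)
  have e2 := sum_comp_eq_of_mem_Icc _ hd (fun n => n ^ 2)
  simp only [sum_const, card_univ, smul_eq_mul, mul_one, hcardW] at e0
  rw [hdeg1] at e1
  rw [hdeg2] at e2
  have hsub : univ.map f.toEmbedding ⊆ univ.filter (fun v => ¬ H.degree v = 1) := by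
    intro v hv
    obtain ⟨a, -, rfl⟩ := mem_map.1 hv
    refine mem_filter.2 ⟨mem_univ _, ?_⟩
    have : 2 ≤ H.degree (f.toEmbedding a) := hf2 a
    omega
  have hcardf : #(univ.map f.toEmbedding) = m' + 3 := by simp
  have hsplit := card_filter_add_card_filter_not (s := (univ : Finset W))
    (fun v => H.degree v = 1)
  rw [card_univ, hcardW] at hsplit
  have hle' := card_le_card hsub
  rw [hcardf] at hle'
  -- Let `n_d` count vertices of degree `d`. Summing `d - 2` and `(d - 2) (d - 3)` gives `n₁ = n₃ +
  -- 2 n₄` and `n₁ + n₄ = 3 k + 1`, so `n₃ = 3 (k - n₄) + 1`. Now `n₃ ≥ 0` yields `n₄ ≤ k`, and `n₁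
  -- ≤ 2 k + 1`, from the cycle vertices not being leaves, yields `n₄ ≥ k`.
  have hn3 : #{v | H.degree v = 3} = 1 := by omega
  have hn4 : #{v | H.degree v = 4} = k := by omega
  -- Now `n₁ = 2 k + 1`, so exactly as many vertices are non-leaves as lie on the cycle.
  have heq := eq_of_subset_of_card_le hsub (by rw [hcardf]; omega)
  have hrange : Set.range f = H.core := by
    ext v
    have : v ∈ univ.map f.toEmbedding ↔ v ∈ univ.filter (fun v => ¬ H.degree v = 1) := by rw [heq]
    rw [Set.mem_range, core, Set.mem_ofPred_eq]
    simpa using this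
  have hcount : ∀ n, n ≠ 0 → #{a | H.degree (f a) - 2 = n} = #{v | H.degree v = n + 2} := by
    intro n hn
    rw [← card_map f.toEmbedding]
    congr 1
    ext v
    simp only [mem_map, mem_filter, mem_univ, true_and]
    constructor
    · rintro ⟨a, ha, rfl⟩
      change H.degree (f a) = n + 2
      omega
    · intro hv
      obtain ⟨a, rfl⟩ : v ∈ Set.range f := by
        rw [hrange]
        change H.degree v ≠ 1
        omega
      exact ⟨a, by omega, rfl⟩
  refine ⟨fun a => H.degree (f a) - 2, ⟨fun a => ?_, ?_, ?_⟩,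
    nonempty_iso_sunGraph hconn f hrange⟩
  · have := hle (f a); omega
  · rw [hcount 1 one_ne_zero, hn3]
  · rw [hcount 2 two_ne_zero, hn4]

/-! ### Nice patterns and the spacing of their hubs. -/

/-- The pattern of leaf counts of a nice graph: `p 0, …, p k` are the positions of the hubs. -/
structure NicePattern {n : ℕ} (k : ℕ) (i : Fin n → ℕ) (p : ℕ → ℕ) : Prop where
  one_le : 1 ≤ k
  le_length : 12 * k ≤ n
  length_ge : 15 ≤ n
  zero : p 0 = 0
  one : p 1 = 4
  step : ∀ t < k, p (t + 1) = p t + 4 ∨ p (t + 1) = p t + 6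
  le_two : ∀ a, i a ≤ 2
  eq_one_iff : ∀ a, i a = 1 ↔ a.val = 0
  eq_two_iff : ∀ a, i a = 2 ↔ ∃ t, 1 ≤ t ∧ t ≤ k ∧ a.val = p t

theorem IsNice.exists_pattern {V : Type u} [Fintype V] {G : SimpleGraph V}
    [DecidableRel G.Adj] {m k : ℕ} (hG : G.IsNice (m + 3) k) :
    ∃ i p, NicePattern (n := m + 3) k i p ∧ Nonempty (sunGraph i ≃g G) := by
  classical
  obtain ⟨hk, hℓ, ⟨hconn, -⟩, c', p, hp0, hstep, h1, h2, h3⟩ := hG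
  let c : cycleGraph (m + 3) ↪g G := (Embedding.induce G.core).comp c'.toEmbedding
  have hcc : ∀ a, c a = (c' a : V) := fun _ => rfl
  have hc : Set.range c = G.core := by
    ext v
    constructor
    · rintro ⟨a, rfl⟩
      exact (c' a).2
    · intro hv
      obtain ⟨a, ha⟩ := c'.surjective ⟨v, hv⟩
      exact ⟨a, by rw [hcc, ha]⟩
  have hge : ∀ a, 2 ≤ G.degree (c a) := fun a => by
    rw [degree_eq_two_add_card_leaves c hc]; omega
  have hle : ∀ a, G.degree (c a) ≤ 4 := by
    intro a
    by_contra hlt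
    exact h3 (G.degree (c a) - 2) (c a) (by omega) ⟨by omega, by omega⟩
  have hone : ∀ a, G.degree (c a) = 3 ↔ a = p 0 := by
    intro a
    have := h1 (c a)
    rw [← hcc, c.injective.eq_iff] at this
    rw [← this, IsHubOfOrder]
    simp
  have htwo : ∀ a, G.degree (c a) = 4 ↔ ∃ t : Fin k, a = p t.succ := by
    intro a
    have := h2 (c a)
    simp only [← hcc, c.injective.eq_iff] at this
    rw [← this, IsHubOfOrder]
    simp
  -- The positions are extended to all of `ℕ`; the value `0` beyond `k` is never used.
  refine ⟨fun a => G.degree (c a) - 2, fun t => if ht : t < k + 1 then p ⟨t, ht⟩ else 0,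
    ⟨hk, le_trans (le_max_left _ _) hℓ, le_trans (le_max_right _ _) hℓ, ?_, ?_, ?_, ?_, ?_, ?_⟩,
    nonempty_iso_sunGraph hconn c hc⟩
  · simpa using hp0
  · have := hstep ⟨0, hk⟩
    simp only [ne_eq, not_true_eq_false, false_and, or_false] at this
    rw [dif_pos (by omega)]
    have h0 : p (Fin.castSucc ⟨0, hk⟩) = p 0 := rfl
    rw [h0, hp0] at this
    exact this
  · intro t ht
    have := hstep ⟨t, ht⟩
    rw [dif_pos (by omega), dif_pos (by omega)]
    rcases this with h | ⟨-, h⟩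
    · exact Or.inl h
    · exact Or.inr h
  · intro a
    have := hle a
    omega
  · intro a
    have h' := hone a
    have := hge a
    rw [Fin.ext_iff, hp0] at h'
    rw [← h']
    omega
  · intro a
    have h' := htwo a
    have := hge a
    have h4 : G.degree (c a) - 2 = 2 ↔ G.degree (c a) = 4 := by omega
    rw [h4, h']
    constructor
    · rintro ⟨t, rfl⟩
      refine ⟨t + 1, by omega, by omega, ?_⟩
      rw [dif_pos (by omega)]
      rfl
    · rintro ⟨t, ht1, htk, hat⟩
      rw [dif_pos (by omega)] at hat
      refine ⟨⟨t - 1, by omega⟩, Fin.ext ?_⟩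
      rw [hat]
      congr 2
      ext
      rw [Fin.val_succ]
      exact (Nat.sub_add_cancel ht1).symm

namespace NicePattern

variable {n k : ℕ} {i : Fin n → ℕ} {p : ℕ → ℕ}

theorem add_le (h : NicePattern k i p) {s t : ℕ} (hst : s < t) (ht : t ≤ k) : p s + 4 ≤ p t := by
  induction t with
  | zero => omega
  | succ t ih =>
    have := h.step t (by omega)
    by_cases hs : s = t
    · subst hs; omega
    · have := ih (by omega) (by omega)
      omega

/-- The gain of two over `6 * t` comes from the first gap being `4` rather than `6`. -/
theorem le_add (h : NicePattern k i p) {t : ℕ} (ht1 : 1 ≤ t) (ht : t ≤ k) : p t + 2 ≤ 6 * t := by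
  induction t with
  | zero => omega
  | succ t ih =>
    have := h.step t (by omega)
    by_cases hs : t = 0
    · subst hs
      rw [zero_add, h.one]
    · have := ih (by omega) (by omega)
      omega

/-- All hubs lie strictly inside one half of the cycle, with a margin. This keeps them apart from
their mirror images. -/
theorem lt_length (h : NicePattern k i p) {t : ℕ} (ht1 : 1 ≤ t) (ht : t ≤ k) : 2 * p t + 4 ≤ n := by
  have := h.le_add ht1 ht
  have := h.le_length
  omega

theorem four_le (h : NicePattern k i p) {t : ℕ} (ht1 : 1 ≤ t) (ht : t ≤ k) : 4 ≤ p t := by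
  have := h.add_le (s := 0) ht1 ht
  omega

end NicePattern

/-! ### Truncating the Leibniz formula after transpositions. -/

section Leibniz

theorem isSwap_iff_exists_lt {ι : Type*} [LinearOrder ι] {σ : Equiv.Perm ι} :
    σ.IsSwap ↔ ∃ a b, a < b ∧ σ = Equiv.swap a b := by
  constructor
  · rintro ⟨a, b, hab, rfl⟩
    rcases lt_or_gt_of_ne hab with h | h
    · exact ⟨a, b, h, rfl⟩
    · exact ⟨b, a, h, Equiv.swap_comm a b⟩
  · rintro ⟨a, b, hab, rfl⟩
    exact ⟨a, b, hab.ne, rfl⟩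

/-- Second order expansion of a determinant with unit diagonal. -/
theorem det_sub_mem_of_prod_mem {ι R : Type*} [Fintype ι] [LinearOrder ι] [CommRing R] (M : Matrix ι ι R) (hM : ∀ a, M a a = 1) (I : Ideal R)
    (hI : ∀ σ : Equiv.Perm ι, 3 ≤ #σ.support → ∏ c, M (σ c) c ∈ I) :
    M.det - (1 - ∑ q ∈ univ.filter (fun q : ι × ι => q.1 < q.2), M q.1 q.2 * M q.2 q.1) ∈ I := by
  set f : Equiv.Perm ι → R := fun σ => Equiv.Perm.sign σ • ∏ c, M (σ c) c with hf
  -- No permutation moves exactly one point, so below support size three only the identity and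
  -- transpositions remain.
  have hsplit : univ.filter (fun σ : Equiv.Perm ι => ¬ 3 ≤ #σ.support)
      = insert 1 ((univ.filter (fun q : ι × ι => q.1 < q.2)).image
        (fun q => Equiv.swap q.1 q.2)) := by
    ext σ
    simp only [mem_filter, mem_univ, true_and, mem_insert, mem_image, Prod.exists]
    have h1 : #σ.support ≠ 1 := Equiv.Perm.card_support_ne_one σ
    have h0 : #σ.support = 0 ↔ σ = 1 := Equiv.Perm.card_support_eq_zero
    have h2 : #σ.support = 2 ↔ ∃ a b, a < b ∧ Equiv.swap a b = σ := by
      rw [Equiv.Perm.card_support_eq_two, isSwap_iff_exists_lt]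
      simp only [eq_comm]
    rw [← h0, ← h2]
    omega
  have hinj : Set.InjOn (fun q : ι × ι => Equiv.swap q.1 q.2)
      (univ.filter (fun q : ι × ι => q.1 < q.2) : Finset (ι × ι)) := by
    rintro ⟨a, b⟩ hab ⟨c, d⟩ hcd h
    have hab' : a < b := by simpa using hab
    have hcd' : c < d := by simpa using hcd
    have h' : Equiv.swap a b = Equiv.swap c d := h
    have hs := congrArg Equiv.Perm.support h'
    rw [Equiv.Perm.support_swap hab'.ne, Equiv.Perm.support_swap hcd'.ne] at hs
    have ha : a ∈ ({c, d} : Finset ι) := by rw [← hs]; simp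
    have hb : b ∈ ({c, d} : Finset ι) := by rw [← hs]; simp
    simp only [mem_insert, mem_singleton] at ha hb
    rcases ha with rfl | rfl <;> rcases hb with rfl | rfl
    · exact absurd hab' (lt_irrefl _)
    · rfl
    · exact absurd (hab'.trans hcd') (lt_irrefl _)
    · exact absurd hab' (lt_irrefl _)
  have hnot : (1 : Equiv.Perm ι) ∉ (univ.filter (fun q : ι × ι => q.1 < q.2)).image
      (fun q => Equiv.swap q.1 q.2) := by
    simp only [mem_image, mem_filter, mem_univ, true_and, Prod.exists, not_exists, not_and]
    intro a b hab h
    exact hab.ne (Equiv.swap_eq_one_iff.1 h)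
  have hswap : ∀ q ∈ univ.filter (fun q : ι × ι => q.1 < q.2),
      f (Equiv.swap q.1 q.2) = -(M q.1 q.2 * M q.2 q.1) := by
    rintro ⟨a, b⟩ hab
    have hab' : a ≠ b := (by simpa using hab : a < b).ne
    simp only [hf]
    rw [Equiv.Perm.sign_swap hab', Fintype.prod_eq_mul a b hab']
    · simp [mul_comm]
    · rintro x ⟨hxa, hxb⟩
      rw [Equiv.swap_apply_of_ne_of_ne hxa hxb, hM]
  have hdet : M.det = ∑ σ ∈ univ.filter (fun σ : Equiv.Perm ι => 3 ≤ #σ.support), f σ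
      + (1 - ∑ q ∈ univ.filter (fun q : ι × ι => q.1 < q.2), M q.1 q.2 * M q.2 q.1) := by
    rw [det_apply, ← sum_filter_add_sum_filter_not univ (fun σ : Equiv.Perm ι => 3 ≤ #σ.support),
      hsplit, sum_insert hnot, sum_image hinj, sum_congr rfl hswap, sum_neg_distrib]
    congr 1
    simp [hM, sub_eq_add_neg]
  rw [hdet, add_sub_cancel_right]
  refine I.sum_mem fun σ hσ => ?_
  have := hI σ (mem_filter.1 hσ).2
  rcases Int.units_eq_one_or (Equiv.Perm.sign σ) with h | h
  · simpa [hf, h] using this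
  · simpa [hf, h] using this

theorem pow_dvd_prod_of_card_le {ι R : Type*} [Fintype ι] [CommRing R] {d : R} {f : ι → R} {T : Finset ι} {r : ℕ} (hr : r ≤ #T)
    (h : ∀ c ∈ T, d ∣ f c) : d ^ r ∣ ∏ c, f c :=
  calc d ^ r ∣ d ^ #T := pow_dvd_pow d hr
    _ = ∏ _c ∈ T, d := by rw [prod_const]
    _ ∣ ∏ c ∈ T, f c := prod_dvd_prod_of_dvd _ _ h
    _ ∣ ∏ c, f c := prod_dvd_prod_of_subset _ _ _ (subset_univ T)

end Leibniz

/-! ### Elimination of leaves and the resolvent of the cycle. -/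

section Green

variable {R : Type*} [CommRing R] (x : R)

/-- The kernel `x ^ d + x ^ (n - d)` of the resolvent of the cycle of length `n`. -/
def cycleKernel (n d : ℕ) : R := x ^ d + x ^ (n - d)

/-- The difference of positions of two vertices of the cycle. -/
def finDist {n : ℕ} (a b : Fin n) : ℕ := ((a : ℤ) - b).natAbs

theorem finDist_comm {n : ℕ} (a b : Fin n) : finDist a b = finDist b a := by
  unfold finDist; omega

theorem finDist_self {n : ℕ} (a : Fin n) : finDist a a = 0 := by
  unfold finDist; omega

theorem finDist_lt {n : ℕ} (a b : Fin n) : finDist a b < n := by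
  unfold finDist; omega

theorem cycleKernel_sub {n d : ℕ} (hd : d ≤ n) : cycleKernel x n (n - d) = cycleKernel x n d := by
  rw [cycleKernel, cycleKernel, Nat.sub_sub_self hd, add_comm]

theorem cycleKernel_recurrence {n d : ℕ} (hd : d + 2 ≤ n) :
    (1 + x ^ 2) * cycleKernel x n (d + 1) = x * (cycleKernel x n d + cycleKernel x n (d + 2)) := by
  obtain ⟨e, rfl⟩ := Nat.exists_eq_add_of_le hd
  have h1 : d + 2 + e - (d + 1) = e + 1 := by omega
  have h2 : d + 2 + e - d = e + 2 := by omega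
  have h3 : d + 2 + e - (d + 2) = e := by omega
  simp only [cycleKernel, h1, h2, h3]
  ring

/-- The matrix `(1 + x ^ 2) - x * A` where `A` is the adjacency matrix of the cycle. -/
def cycleResolvent (m : ℕ) : Matrix (Fin (m + 3)) (Fin (m + 3)) R :=
  Matrix.of fun a b => (if a = b then 1 + x ^ 2 else 0) - if (cycleGraph (m + 3)).Adj a b then x else 0

/-- The wrap-around at the last vertex replaces a distance `d` by `n - d`, which the kernel does not
see. -/
theorem cycleKernel_succ {m : ℕ} (a b : Fin (m + 3)) :
    cycleKernel x (m + 3) (finDist (a + 1) b)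
      = cycleKernel x (m + 3) ((a : ℤ) + 1 - b).natAbs := by
  by_cases ha : a = Fin.last (m + 2)
  · subst ha
    rw [Fin.last_add_one, ← cycleKernel_sub x (finDist_lt 0 b).le]
    congr 1
    have := b.2
    simp only [finDist, Fin.val_last, Fin.val_zero]
    omega
  · have := Fin.val_add_one_of_lt (Fin.lt_last_iff_ne_last.2 ha)
    rw [finDist, this]
    push_cast
    rfl

theorem cycleKernel_pred {m : ℕ} (a b : Fin (m + 3)) :
    cycleKernel x (m + 3) (finDist (a - 1) b)
      = cycleKernel x (m + 3) ((a : ℤ) - 1 - b).natAbs := by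
  by_cases ha : a = 0
  · subst ha
    have h1 : ((0 : Fin (m + 3)) - 1) = Fin.last (m + 2) := by
      rw [sub_eq_iff_eq_add, Fin.last_add_one]
    rw [h1, ← cycleKernel_sub x (finDist_lt _ b).le]
    congr 1
    have := b.2
    simp only [finDist, Fin.val_last, Fin.val_zero]
    omega
  · have h1 : ((a - 1 : Fin (m + 3)) : ℕ) = a - 1 := by
      rw [Fin.val_sub_one_of_ne_zero ha]
    have h2 : (a : ℕ) ≠ 0 := fun h => ha (Fin.ext h)
    unfold finDist
    rw [h1]
    congr 2
    omega

/-- Off the diagonal the kernel satisfies the three-term recurrence of the cycle; on the diagonal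
the recurrence fails by exactly the scalar on the right. -/
theorem cycleResolvent_mul_cycleKernel (m : ℕ) :
    cycleResolvent x m * Matrix.of (fun a b => cycleKernel x (m + 3) (finDist a b))
      = ((1 - x ^ 2) * (1 - x ^ (m + 3))) • (1 : Matrix (Fin (m + 3)) (Fin (m + 3)) R) := by
  ext a b
  have hne : a - 1 ≠ a + 1 := by
    intro h
    have h2 : (1 : Fin (m + 3)) + 1 = 0 := by
      have : a + (1 + 1) = a := by rw [← add_assoc, ← h, sub_add_cancel]
      exact add_eq_left.1 this
    exact absurd h2 (ne_of_beq_false rfl)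
  have hsum : (cycleResolvent x m *
      Matrix.of (fun a b => cycleKernel x (m + 3) (finDist a b)) : Matrix _ _ R) a b
      = (1 + x ^ 2) * cycleKernel x (m + 3) (finDist a b)
        - x * (cycleKernel x (m + 3) ((a : ℤ) - 1 - b).natAbs
          + cycleKernel x (m + 3) ((a : ℤ) + 1 - b).natAbs) := by
    rw [mul_apply]
    simp only [cycleResolvent, of_apply, sub_mul, ite_mul, zero_mul, sum_sub_distrib, sum_ite_eq,
      mem_univ, if_true]
    rw [← sum_filter, ← neighborFinset_eq_filter, cycleGraph_neighborFinset, sum_pair hne,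
      cycleKernel_succ, cycleKernel_pred]
    ring
  rw [hsum, Matrix.smul_apply, one_apply, smul_eq_mul]
  have ha := a.2
  have hb := b.2
  by_cases hab : a = b
  · subst hab
    have h1 : ((a : ℤ) - 1 - a).natAbs = 1 := by omega
    have h2 : ((a : ℤ) + 1 - a).natAbs = 1 := by omega
    rw [h1, h2, finDist_self, if_pos rfl]
    simp only [cycleKernel, Nat.sub_zero, show m + 3 - 1 = m + 2 by omega]
    ring
  · have hab' : (a : ℕ) ≠ b := fun h => hab (Fin.ext h)
    rw [if_neg hab, mul_zero, sub_eq_zero]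
    rcases lt_or_gt_of_ne hab' with hlt | hlt
    · obtain ⟨d, hd⟩ := Nat.exists_eq_add_of_lt hlt
      have h0 : finDist a b = d + 1 := by unfold finDist; omega
      have h1 : ((a : ℤ) - 1 - b).natAbs = d + 2 := by omega
      have h2 : ((a : ℤ) + 1 - b).natAbs = d := by omega
      rw [h0, h1, h2, cycleKernel_recurrence x (by omega), add_comm]
    · obtain ⟨d, hd⟩ := Nat.exists_eq_add_of_lt hlt
      have h0 : finDist a b = d + 1 := by unfold finDist; omega
      have h1 : ((a : ℤ) - 1 - b).natAbs = d := by omega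
      have h2 : ((a : ℤ) + 1 - b).natAbs = d + 2 := by omega
      rw [h0, h1, h2, cycleKernel_recurrence x (by omega)]

/-- Elimination of the leaves of a sun graph. -/
theorem det_sunGraph_eq {m : ℕ} (i : Fin (m + 3) → ℕ) {h : R} (hh : (1 - x + x ^ 2) * h = 1) :
    ((1 - x) ^ 2 • (1 : Matrix _ _ R) + x • (sunGraph i).lapMatrix R).det
      = (1 - x + x ^ 2) ^ (∑ a, i a)
        * (cycleResolvent x m + (x - x ^ 2 * h) • diagonal (fun a => (i a : R))).det := by
  set A : Matrix (Fin (m + 3)) (Fin (m + 3)) R := cycleResolvent x m + x • diagonal (fun a => (i a : R))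
  set B : Matrix (Fin (m + 3)) (Σ a, Fin (i a)) R := Matrix.of fun a p => if a = p.1 then -x else 0
  set D : Matrix (Σ a, Fin (i a)) (Σ a, Fin (i a)) R := (1 - x + x ^ 2) • 1
  -- The coefficients `(1 - x) ^ 2` and `x` are chosen so that a cycle vertex of degree two has
  -- diagonal entry `1 + x ^ 2`. A leaf has `1 - x + x ^ 2`, with inverse `h`.
  have hblock : (1 - x) ^ 2 • (1 : Matrix _ _ R) + x • (sunGraph i).lapMatrix R
      = fromBlocks A B Bᵀ D := by
    ext (a | p) (b | q)
    · simp only [Matrix.add_apply, Matrix.smul_apply, one_apply, lapMatrix_apply,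
        degree_sunGraph_inl, fromBlocks_apply₁₁, A, cycleResolvent, of_apply, diagonal_apply,
        Sum.inl.injEq, sunGraph_adj_inl_inl, smul_eq_mul]
      split_ifs <;> push_cast <;> ring
    · simp only [Matrix.add_apply, Matrix.smul_apply, one_apply, lapMatrix_apply,
        fromBlocks_apply₁₂, B, of_apply, reduceCtorEq, if_false, sunGraph_adj_inl_inr, smul_eq_mul]
      split_ifs <;> ring
    · simp only [Matrix.add_apply, Matrix.smul_apply, one_apply, lapMatrix_apply,
        fromBlocks_apply₂₁, B, transpose_apply, of_apply, reduceCtorEq, if_false,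
        sunGraph_adj_inr_inl, smul_eq_mul]
      split_ifs <;> ring
    · simp only [Matrix.add_apply, Matrix.smul_apply, one_apply, lapMatrix_apply,
        degree_sunGraph_inr, fromBlocks_apply₂₂, D, Sum.inr.injEq, sunGraph_adj_inr_inr,
        smul_eq_mul, if_false]
      split_ifs <;> push_cast <;> ring
  let _ : Invertible D := ⟨h • 1, by simp [D, smul_smul, hh],
    by simp [D, smul_smul, mul_comm h, hh]⟩
  have hinv : ⅟D = h • 1 := rfl
  have hBB : B * Bᵀ = x ^ 2 • diagonal (fun a => (i a : R)) := by
    ext a b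
    rw [mul_apply, Fintype.sum_sigma]
    simp only [B, of_apply, transpose_apply, Matrix.smul_apply, diagonal_apply, smul_eq_mul]
    rw [Fintype.sum_eq_single a]
    · by_cases hab : a = b
      · subst hab; simp; ring
      · simp [hab, Ne.symm hab]
    · intro c hc
      simp [hc.symm]
  rw [hblock, det_fromBlocks₂₂, hinv, det_smul, det_one, mul_one]
  congr 1
  · rw [Fintype.card_sigma]; simp
  · rw [Matrix.mul_smul, Matrix.mul_one, Matrix.smul_mul, hBB]
    congr 1
    rw [smul_smul, add_sub_assoc, ← sub_smul, mul_comm h]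

/-- The off-diagonal part of the interaction matrix of the hubs. -/
def hubMatrix {m : ℕ} (β : Fin (m + 3) → R) : Matrix (Fin (m + 3)) (Fin (m + 3)) R :=
  Matrix.of fun a b => if a = b then 1 else cycleKernel x (m + 3) (finDist a b) * β b

/-- Factor out the cycle matrix, using that `z` times the kernel matrix is its inverse, then divide
each column by its diagonal entry. Here `β` is the weight left on the off-diagonal entries. -/
theorem det_cycleResolvent_add {m : ℕ} (i : Fin (m + 3) → ℕ) {u z w : R} {β : Fin (m + 3) → R}
    (hz : (1 - x ^ 2) * (1 - x ^ (m + 3)) * z = 1) (hw : w = u * z)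
    (hβ : ∀ a, β a * (1 + w * (1 + x ^ (m + 3)) * i a) = w * i a) :
    (cycleResolvent x m + u • diagonal (fun a => (i a : R))).det
      = (cycleResolvent x m).det * (hubMatrix x β).det
        * ∏ a, (1 + w * (1 + x ^ (m + 3)) * i a) := by
  have h1 : cycleResolvent x m + u • diagonal (fun a => (i a : R))
      = cycleResolvent x m * (1 + w • (Matrix.of (fun a b => cycleKernel x (m + 3) (finDist a b))
        * diagonal (fun a => (i a : R)))) := by
    rw [mul_add, mul_one, mul_smul_comm, ← mul_assoc, cycleResolvent_mul_cycleKernel,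
      smul_mul_assoc, one_mul, smul_smul, hw]
    congr 2
    linear_combination (-u) * hz
  have h2 : 1 + w • (Matrix.of (fun a b => cycleKernel x (m + 3) (finDist a b))
        * diagonal (fun a => (i a : R)))
      = hubMatrix x β * diagonal (fun a => 1 + w * (1 + x ^ (m + 3)) * i a) := by
    ext a b
    rw [mul_diagonal, Matrix.add_apply, Matrix.smul_apply, mul_diagonal, one_apply, smul_eq_mul]
    simp only [of_apply, hubMatrix]
    by_cases hab : a = b
    · subst hab
      simp only [if_true, finDist_self, cycleKernel, Nat.sub_zero, pow_zero]
      ring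
    · simp only [hab, if_false]
      linear_combination (-cycleKernel x (m + 3) (finDist a b)) * hβ b
  rw [h1, h2, det_mul, det_mul, det_diagonal, mul_assoc]

end Green

/-! ### The hub interaction determinant as a spectral invariant. -/

open scoped PowerSeries

open PowerSeries (X constantCoeff coeff)

/-- The weights of the hubs in the interaction matrix, by number of leaves. -/
noncomputable def hubWeight (r₁ r₂ : ℤ⟦X⟧) : ℕ → ℤ⟦X⟧
  | 1 => X * r₁
  | 2 => 2 * X * r₂
  | _ => 0

theorem ne_zero_of_constantCoeff_eq_one {f : ℤ⟦X⟧} (hf : constantCoeff f = 1) : f ≠ 0 := by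
  rintro rfl
  simp at hf

/-- The determinant of the interaction matrix is determined by the Laplacian spectrum. -/
theorem exists_det_hubMatrix_eq (m : ℕ) : ∃ r₁ r₂ : ℤ⟦X⟧, constantCoeff r₁ = 1 ∧
    constantCoeff r₂ = 1 ∧ ∀ (k : ℕ) (i j : Fin (m + 3) → ℕ), HubCounts k i → HubCounts k j →
      (sunGraph j).lapSpectrum = (sunGraph i).lapSpectrum →
      (hubMatrix X fun a => hubWeight r₁ r₂ (j a)).det
        = (hubMatrix X fun a => hubWeight r₁ r₂ (i a)).det := by
  obtain ⟨h, hh⟩ : ∃ h : ℤ⟦X⟧, (1 - X + X ^ 2) * h = 1 :=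
    ⟨_, PowerSeries.mul_invOfUnit _ 1 (by simp)⟩
  obtain ⟨z, hz⟩ : ∃ z : ℤ⟦X⟧, (1 - X ^ 2) * (1 - X ^ (m + 3)) * z = 1 :=
    ⟨_, PowerSeries.mul_invOfUnit _ 1 (by simp)⟩
  have hz0 : constantCoeff z = 1 := by
    have := congrArg constantCoeff hz
    simpa using this
  obtain ⟨w₁, hw₁⟩ : ∃ w₁ : ℤ⟦X⟧, w₁ = (1 - X * h) * z := ⟨_, rfl⟩
  have hw0 : constantCoeff w₁ = 1 := by simp [hw₁, hz0]
  set F : ℕ → ℤ⟦X⟧ := fun n => 1 + X * w₁ * (1 + X ^ (m + 3)) * (n : ℤ⟦X⟧) with hF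
  have hF0 : ∀ n, constantCoeff (F n) = 1 := fun n => by simp [hF]
  have hinv : ∀ n, ∃ g, F n * g = 1 := fun n =>
    ⟨_, PowerSeries.mul_invOfUnit _ 1 (hF0 n)⟩
  choose g hg using hinv
  have hg0 : ∀ n, constantCoeff (g n) = 1 := by
    intro n
    have := congrArg constantCoeff (hg n)
    rwa [map_mul, hF0, one_mul, map_one] at this
  refine ⟨w₁ * g 1, w₁ * g 2, by rw [map_mul, hw0, hg0, one_mul],
    by rw [map_mul, hw0, hg0, one_mul], ?_⟩
  intro k i j hi hj hspec
  -- The weight of a vertex with `n` leaves is `X w₁ n / F n`. The factors `X` and `n` are kept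
  -- visible for the two truncations.
  have hβ : ∀ n ≤ 2, hubWeight (w₁ * g 1) (w₁ * g 2) n * F n = X * w₁ * (n : ℤ⟦X⟧) := by
    intro n hn
    interval_cases n
    · simp [hubWeight]
    · simp only [hubWeight]
      push_cast
      linear_combination (X * w₁) * hg 1
    · simp only [hubWeight]
      push_cast
      linear_combination (2 * X * w₁) * hg 2
  have hdet := det_homogeneous_eq_of_lapSpectrum_eq hspec ((1 - X) ^ 2 : ℤ⟦X⟧) X
    PowerSeries.X_ne_zero
  rw [det_sunGraph_eq X _ hh, det_sunGraph_eq X _ hh,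
    hi.sum_eq (fun n => n) rfl, hj.sum_eq (fun n => n) rfl,
    det_cycleResolvent_add X i (u := X - X ^ 2 * h) (w := X * w₁) hz (by rw [hw₁]; ring)
      (fun a => hβ _ (hi.le_two a)),
    det_cycleResolvent_add X j (u := X - X ^ 2 * h) (w := X * w₁) hz (by rw [hw₁]; ring)
      (fun a => hβ _ (hj.le_two a))] at hdet
  have hpi := hi.prod_eq F (by simp [hF])
  have hpj := hj.prod_eq F (by simp [hF])
  simp only [hF] at hpi hpj
  rw [hpi, hpj] at hdet
  have hC : constantCoeff (cycleResolvent (X : ℤ⟦X⟧) m).det = 1 := by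
    rw [RingHom.map_det, RingHom.mapMatrix_apply]
    have : (cycleResolvent (X : ℤ⟦X⟧) m).map constantCoeff = 1 := by
      ext a b
      simp only [Matrix.map_apply, cycleResolvent, of_apply, one_apply, map_sub]
      split_ifs <;> simp
    rw [this, det_one]
  have h1 : ((1 - X + X ^ 2) ^ (1 + k * 2) : ℤ⟦X⟧) ≠ 0 :=
    ne_zero_of_constantCoeff_eq_one (by simp)
  have h2 : F 1 * F 2 ^ k ≠ 0 :=
    ne_zero_of_constantCoeff_eq_one (by simp [hF0])
  exact mul_left_cancel₀ (ne_zero_of_constantCoeff_eq_one hC)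
    (mul_right_cancel₀ h2 (mul_left_cancel₀ h1 hdet))

/-! ### Truncations modulo `4` and modulo `X ^ 15`. -/

/-- The second order term of the determinant of the interaction matrix. -/
noncomputable def pairSum {m : ℕ} (β : Fin (m + 3) → ℤ⟦X⟧) : ℤ⟦X⟧ :=
  ∑ q ∈ univ.filter (fun q : Fin (m + 3) × Fin (m + 3) => q.1 < q.2),
    cycleKernel X (m + 3) (finDist q.1 q.2) ^ 2 * (β q.1 * β q.2)

theorem det_hubMatrix_sub_mem {m : ℕ} (β : Fin (m + 3) → ℤ⟦X⟧) (I : Ideal ℤ⟦X⟧)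
    (hI : ∀ σ : Equiv.Perm (Fin (m + 3)), 3 ≤ #σ.support → ∏ c, hubMatrix X β (σ c) c ∈ I) :
    (hubMatrix X β).det - (1 - pairSum β) ∈ I := by
  have := det_sub_mem_of_prod_mem (hubMatrix X β) (fun a => by simp [hubMatrix]) I hI
  convert this using 3
  refine sum_congr rfl fun q hq => ?_
  have hq' : q.1 ≠ q.2 := (by simpa using hq : q.1 < q.2).ne
  simp only [hubMatrix, of_apply, hq', hq'.symm, if_false, finDist_comm q.2 q.1]
  ring

theorem hubMatrix_apply_of_ne {m : ℕ} (β : Fin (m + 3) → ℤ⟦X⟧) {a b : Fin (m + 3)} (h : a ≠ b) :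
    hubMatrix X β a b = cycleKernel X (m + 3) (finDist a b) * β b := if_neg h

/-- Modulo `4` only the pairs containing the vertex with one leaf contribute. -/
theorem det_hubMatrix_mod_four {m : ℕ} (r₁ r₂ : ℤ⟦X⟧) {i : Fin (m + 3) → ℕ}
    (hi : ∀ a, i a ≤ 2) (h1 : ∀ a, i a = 1 ↔ a = 0) :
    (4 : ℤ⟦X⟧) ∣ (hubMatrix X fun a => hubWeight r₁ r₂ (i a)).det
      - (1 - 2 * (X ^ 2 * r₁ * r₂) * ∑ b ∈ univ.filter (fun b => i b = 2),
        cycleKernel X (m + 3) b ^ 2) := by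
  set β : Fin (m + 3) → ℤ⟦X⟧ := fun a => hubWeight r₁ r₂ (i a) with hβ
  have hβ2 : ∀ a, a ≠ 0 → (2 : ℤ⟦X⟧) ∣ β a := by
    intro a ha
    have h2 := hi a
    have h3 : i a ≠ 1 := fun h => ha ((h1 a).1 h)
    simp only [hβ]
    interval_cases hia : i a
    · exact dvd_zero _
    · exact absurd rfl h3
    · exact ⟨X * r₂, by simp only [hubWeight]; ring⟩
  have key := det_hubMatrix_sub_mem β (Ideal.span {4}) ?_
  · rw [Ideal.mem_span_singleton] at key
    have hpair : (4 : ℤ⟦X⟧) ∣ pairSum β - 2 * (X ^ 2 * r₁ * r₂) *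
        ∑ b ∈ univ.filter (fun b => i b = 2), cycleKernel X (m + 3) b ^ 2 := by
      rw [pairSum, ← sum_filter_add_sum_filter_not _ (fun q => q.1 = 0), add_sub_right_comm]
      refine dvd_add ?_ (dvd_sum fun q hq => ?_)
      · refine (dvd_zero _).trans (dvd_of_eq ?_)
        have e1 : (univ.filter (fun q : Fin (m + 3) × Fin (m + 3) => q.1 < q.2)).filter
            (fun q => q.1 = 0) = (univ.filter fun b : Fin (m + 3) => b ≠ 0).image
              (fun b => ((0 : Fin (m + 3)), b)) := by
          ext ⟨a, b⟩
          simp only [mem_filter, mem_univ, true_and, mem_image, Prod.mk.injEq]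
          constructor
          · rintro ⟨hab, rfl⟩
            exact ⟨b, hab.ne', rfl, rfl⟩
          · rintro ⟨c, hc, rfl, rfl⟩
            exact ⟨Fin.pos_iff_ne_zero.2 hc, rfl⟩
        have e2 : ∀ b : Fin (m + 3), finDist 0 b = b := by
          intro b
          simp [finDist]
        rw [e1, sum_image (fun a _ b _ h => (Prod.mk.inj h).2)]
        simp only [e2]
        have hb0 : β 0 = X * r₁ := by
          simp only [hβ, (h1 0).2 rfl, hubWeight]
        rw [mul_sum, sum_filter, sum_filter, eq_comm, sub_eq_zero]
        refine sum_congr rfl fun b _ => ?_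
        rw [hb0]
        have h2 := hi b
        have h3 := h1 b
        simp only [hβ]
        interval_cases hib : i b
        · simp [hubWeight]
        · simp [h3.1 rfl]
        · have : b ≠ 0 := fun h => absurd (h3.2 h) (by norm_num)
          simp only [if_pos this, if_true, hubWeight]
          ring
      · simp only [mem_filter, mem_univ, true_and] at hq
        have hq2 : q.2 ≠ 0 := fun h => by
          have := hq.1
          rw [h] at this
          exact absurd this (Fin.not_lt_zero _)
        have : (4 : ℤ⟦X⟧) = 2 * 2 := by norm_num
        rw [this]
        exact (mul_dvd_mul (hβ2 _ hq.2) (hβ2 _ hq2)).mul_left _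
    have := dvd_sub key hpair
    refine this.trans (dvd_of_eq ?_)
    ring
  · intro σ hσ
    rw [Ideal.mem_span_singleton]
    have h4 : (4 : ℤ⟦X⟧) = 2 ^ 2 := by norm_num
    rw [h4]
    -- A permutation moving three vertices moves at least two besides the 1-hub, and each of their
    -- columns contributes a factor `2`.
    refine pow_dvd_prod_of_card_le (T := σ.support.erase 0) ?_ ?_
    · have := pred_card_le_card_erase (s := σ.support) (a := 0)
      omega
    · intro c hc
      rw [mem_erase, Equiv.Perm.mem_support] at hc
      rw [hubMatrix_apply_of_ne β hc.2]
      exact (hβ2 c hc.1).mul_left _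

/-- Modulo `X ^ 15` only the pairs of hubs contribute when hubs are far apart. -/
theorem det_hubMatrix_mod_X_pow {m : ℕ} (r₁ r₂ : ℤ⟦X⟧) {i : Fin (m + 3) → ℕ}
    (hi : ∀ a, i a ≤ 2) (hfar : ∀ a b, a ≠ b → i a ≠ 0 → i b ≠ 0 →
      4 ≤ finDist a b ∧ finDist a b + 4 ≤ m + 3) :
    (X ^ 15 : ℤ⟦X⟧) ∣ (hubMatrix X fun a => hubWeight r₁ r₂ (i a)).det
      - (1 - pairSum fun a => hubWeight r₁ r₂ (i a)) := by
  rw [← Ideal.mem_span_singleton]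
  refine det_hubMatrix_sub_mem _ _ fun σ hσ => ?_
  by_cases hhub : ∀ c ∈ σ.support, i c ≠ 0
  · rw [Ideal.mem_span_singleton, show 15 = 5 * 3 from rfl, pow_mul]
    refine pow_dvd_prod_of_card_le hσ fun c hc => ?_
    have hc' := Equiv.Perm.mem_support.1 hc
    rw [hubMatrix_apply_of_ne _ hc']
    obtain ⟨hd1, hd2⟩ := hfar (σ c) c hc' (hhub _ (Equiv.Perm.apply_mem_support.2 hc)) (hhub c hc)
    rw [show (5 : ℕ) = 4 + 1 from rfl, pow_add, pow_one]
    refine mul_dvd_mul ?_ ?_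
    · exact dvd_add (pow_dvd_pow _ hd1) (pow_dvd_pow _ (by omega))
    · have h2 := hi c
      interval_cases i c
      · exact dvd_zero _
      · exact ⟨r₁, rfl⟩
      · exact ⟨2 * r₂, by simp only [hubWeight]; ring⟩
  · push Not at hhub
    obtain ⟨c, hc, hic⟩ := hhub
    rw [prod_eq_zero (mem_univ c)]
    · exact Ideal.zero_mem _
    · rw [hubMatrix_apply_of_ne _ (Equiv.Perm.mem_support.1 hc), hic]
      simp [hubWeight]

/-! ### Reading off distances from the 1-hub modulo `2`. -/

theorem cycleKernel_sq {R : Type*} [CommRing R] (x : R) {n d : ℕ} (hd : d ≤ n) :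
    cycleKernel x n d ^ 2 = x ^ (2 * d) + x ^ (2 * (n - d)) + 2 * x ^ n := by
  obtain ⟨e, rfl⟩ := Nat.exists_eq_add_of_le hd
  rw [cycleKernel, Nat.add_sub_cancel_left]
  ring

theorem val_neg_of_ne_zero {m : ℕ} {a : Fin (m + 3)} (ha : a ≠ 0) :
    ((-a : Fin (m + 3)) : ℕ) = m + 3 - a := by
  have h0 : (a : ℕ) ≠ 0 := fun h => ha (Fin.ext h)
  rw [Fin.val_neg', Nat.mod_eq_of_lt (by omega)]

/-- The set of vertices with two leaves is determined up to reflecting individual vertices,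
counted modulo `2`. -/
theorem indicator_add_indicator_neg_eq {m : ℕ} {r₁ r₂ : ℤ⟦X⟧} (hr₁ : constantCoeff r₁ = 1)
    (hr₂ : constantCoeff r₂ = 1) {i j : Fin (m + 3) → ℕ} (hi : ∀ a, i a ≤ 2)
    (hi1 : ∀ a, i a = 1 ↔ a = 0) (hj : ∀ a, j a ≤ 2) (hj1 : ∀ a, j a = 1 ↔ a = 0)
    (hdet : (hubMatrix X fun a => hubWeight r₁ r₂ (j a)).det
        = (hubMatrix X fun a => hubWeight r₁ r₂ (i a)).det) {e : Fin (m + 3)} (he : e ≠ 0) :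
    ((if j e = 2 then 1 else 0) + (if j (-e) = 2 then 1 else 0) : ZMod 2)
      = (if i e = 2 then 1 else 0) + if i (-e) = 2 then 1 else 0 := by
  set S : (Fin (m + 3) → ℕ) → ℤ⟦X⟧ := fun i =>
    ∑ b ∈ univ.filter (fun b => i b = 2), cycleKernel X (m + 3) b ^ 2 with hS
  have h2 : (2 : ℤ⟦X⟧) ∣ (X ^ 2 * r₁ * r₂) * (S j - S i) := by
    have hA := det_hubMatrix_mod_four r₁ r₂ hi hi1
    have hB := det_hubMatrix_mod_four r₁ r₂ hj hj1
    rw [hdet] at hB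
    obtain ⟨c, hc⟩ := dvd_sub hB hA
    -- Pairs formed by the 1-hub and a 2-hub carry one factor `2`; cancelling it turns the
    -- congruence modulo `4` into one modulo `2`.
    refine ⟨c, mul_left_cancel₀ (a := (2 : ℤ⟦X⟧)) (fun h => ?_) ?_⟩
    · have h' := congrArg constantCoeff h
      rw [map_ofNat, map_zero] at h'
      exact absurd h' (by norm_num)
    · linear_combination hc
  set φ := PowerSeries.map (Int.castRingHom (ZMod 2)) with hφ
  have htwo : (2 : (ZMod 2)⟦X⟧) = 0 := by
    have : (2 : (ZMod 2)⟦X⟧) = PowerSeries.C (2 : ZMod 2) := (map_ofNat PowerSeries.C 2).symm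
    rw [this, show (2 : ZMod 2) = 0 from rfl, map_zero]
  have hSφ : φ (S j) = φ (S i) := by
    obtain ⟨c, hc⟩ := h2
    have := congrArg φ hc
    rw [map_mul, map_mul φ 2 c, map_ofNat, htwo, zero_mul, mul_eq_zero, map_sub] at this
    rcases this with h | h
    · exfalso
      -- The factor `X ^ 2 * r₁ * r₂` is nonzero modulo `2`, its coefficient at `X ^ 2` being one.
      have h' := congrArg (PowerSeries.coeff 2) h
      rw [hφ, PowerSeries.coeff_map, mul_assoc, PowerSeries.coeff_X_pow_mul', if_pos le_rfl,
        Nat.sub_self, PowerSeries.coeff_zero_eq_constantCoeff_apply, map_mul, hr₁, hr₂] at h'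
      simp at h'
    · exact sub_eq_zero.1 h
  have hcoeff : ∀ i : Fin (m + 3) → ℕ, coeff (2 * (e : ℕ)) (φ (S i))
      = (if i e = 2 then 1 else 0) + if i (-e) = 2 then 1 else 0 := by
    intro i
    have hterm : ∀ b : Fin (m + 3), coeff (2 * (e : ℕ)) (φ (cycleKernel X (m + 3) b ^ 2))
        = (if b = e then 1 else 0) + if b = -e then 1 else 0 := by
      intro b
      -- Modulo `2` the cross term `2 * X ^ n` disappears, so the coefficient at `2 * e` detects
      -- only `e` and its mirror image.
      rw [cycleKernel_sq X b.2.le]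
      simp only [map_add, map_mul, map_pow, map_ofNat, htwo, zero_mul, add_zero, hφ,
        PowerSeries.map_X, PowerSeries.coeff_X_pow]
      have hneg := val_neg_of_ne_zero he
      have := e.2
      have := b.2
      congr 1
      · simp only [Fin.ext_iff]
        congr 1
        exact propext ⟨fun h => by omega, fun h => by omega⟩
      · simp only [Fin.ext_iff, hneg]
        congr 1
        exact propext ⟨fun h => by omega, fun h => by omega⟩
    simp only [hS, map_sum, hterm]
    rw [sum_add_distrib]
    simp only [sum_ite_eq', mem_filter, mem_univ, true_and]
  rw [← hcoeff j, ← hcoeff i, hSφ]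

/-- The second order term in terms of an enumeration of the hubs. -/
theorem two_mul_pairSum {m k : ℕ} {β : Fin (m + 3) → ℤ⟦X⟧} {P : ℕ → Fin (m + 3)}
    (hP : Set.InjOn P (range (k + 1) : Finset ℕ)) (h0 : ∀ a, a ∉ (range (k + 1)).image P → β a = 0) :
    2 * pairSum β = ∑ s ∈ range (k + 1), ∑ t ∈ range (k + 1), if s = t then 0 else
      cycleKernel X (m + 3) (finDist (P s) (P t)) ^ 2 * (β (P s) * β (P t)) := by
  set f : Fin (m + 3) → Fin (m + 3) → ℤ⟦X⟧ := fun a b =>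
    cycleKernel X (m + 3) (finDist a b) ^ 2 * (β a * β b) with hf
  have hfc : ∀ a b, f a b = f b a := by
    intro a b
    simp only [hf, finDist_comm a b, mul_comm (β a)]
  have h1 : pairSum β = ∑ a, ∑ b, if a < b then f a b else 0 := by
    rw [pairSum, sum_filter, Fintype.sum_prod_type]
  have h2 : pairSum β = ∑ a, ∑ b, if b < a then f a b else 0 := by
    rw [h1, sum_comm]
    simp only [hfc]
  -- Doubling replaces ordered pairs by all pairs, so the enumeration of hubs need not be monotone.
  have h3 : 2 * pairSum β = ∑ a, ∑ b, if a = b then 0 else f a b := by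
    rw [two_mul]
    nth_rewrite 1 [h1]
    rw [h2, ← sum_add_distrib]
    refine sum_congr rfl fun a _ => ?_
    rw [← sum_add_distrib]
    refine sum_congr rfl fun b _ => ?_
    rcases lt_trichotomy a b with h | h | h
    · simp [h, h.ne, h.not_gt]
    · simp [h]
    · simp [h, h.ne', h.not_gt]
  have hres : ∀ g : Fin (m + 3) → ℤ⟦X⟧, (∀ a, β a = 0 → g a = 0) →
      ∑ a, g a = ∑ t ∈ range (k + 1), g (P t) := by
    intro g hg
    rw [← sum_image hP]
    refine (sum_subset (subset_univ _) fun a _ ha => hg a (h0 a ha)).symm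
  rw [h3, hres]
  · refine sum_congr rfl fun s hs => ?_
    rw [hres]
    · refine sum_congr rfl fun t ht => ?_
      simp only [hP.eq_iff hs ht, hf]
    · intro a ha
      simp [hf, ha]
  · intro a ha
    refine sum_eq_zero fun b _ => ?_
    simp [hf, ha]

theorem coeff_cycleKernel_sq {n d e : ℕ} (hd : d ≤ n) (he : 2 * e < n) :
    coeff (2 * e) (cycleKernel (X : ℤ⟦X⟧) n d ^ 2)
      = (if d = e then 1 else 0) + if n - d = e then 1 else 0 := by
  have h2 : (2 : ℤ⟦X⟧) = PowerSeries.C (2 : ℤ) := by simp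
  rw [cycleKernel_sq X hd, map_add, map_add, h2, PowerSeries.coeff_C_mul, PowerSeries.coeff_X_pow,
    PowerSeries.coeff_X_pow, PowerSeries.coeff_X_pow, if_neg he.ne, mul_zero, add_zero]
  congr 1
  · congr 1
    exact propext ⟨fun h => by omega, fun h => by omega⟩
  · congr 1
    exact propext ⟨fun h => by omega, fun h => by omega⟩

/-! ### Consecutive 2-hubs lie on the same side. -/

/-- A choice, for each `t`, between the position `p t` and its mirror image. -/
def mirror (n : ℕ) (p : ℕ → ℕ) (ε : ℕ → Bool) (t : ℕ) : ℕ := if ε t then p t else n - p t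

/-- Two neighboring hubs at distance `4` or `6` lie on the same side. -/
theorem side_eq_of_pairSum {m k : ℕ} {i : Fin (m + 3) → ℕ} {p : ℕ → ℕ} (h : NicePattern k i p)
    {r₁ r₂ : ℤ⟦X⟧} (hr₂ : constantCoeff r₂ = 1)
    {j : Fin (m + 3) → ℕ} {P Q : ℕ → Fin (m + 3)} {ε : ℕ → Bool}
    (hP : ∀ t ≤ k, (P t : ℕ) = p t) (hQ0 : Q 0 = 0)
    (hQ : ∀ t, 1 ≤ t → t ≤ k → (Q t : ℕ) = mirror (m + 3) p ε t)
    (hj : ∀ a, j a ≤ 2) (hj1 : ∀ a, j a = 1 ↔ a = 0)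
    (hj2 : ∀ a, j a = 2 ↔ ∃ t, 1 ≤ t ∧ t ≤ k ∧ a = Q t)
    (hdet : (hubMatrix X fun a => hubWeight r₁ r₂ (j a)).det
        = (hubMatrix X fun a => hubWeight r₁ r₂ (i a)).det) {t : ℕ} (ht1 : 1 ≤ t) (htk : t < k) :
    ε t = ε (t + 1) := by
  have hn := h.length_ge
  have hk := h.le_length
  have hp0 := h.zero
  have hP0 : P 0 = 0 := Fin.ext (by rw [hP 0 (Nat.zero_le k), hp0]; rfl)
  have hsep : ∀ s ≤ k, ∀ t ≤ k, s ≠ t → p s + 4 ≤ p t ∨ p t + 4 ≤ p s := by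
    intro s hs t ht hst
    rcases lt_or_gt_of_ne hst with hlt | hlt
    · exact Or.inl (h.add_le hlt ht)
    · exact Or.inr (h.add_le hlt hs)
  have hlen : ∀ t ≤ k, 2 * p t + 4 ≤ m + 3 := by
    intro t ht
    rcases Nat.eq_zero_or_pos t with rfl | h0
    · omega
    · exact h.lt_length h0 ht
  have hfour : ∀ t, 1 ≤ t → t ≤ k → 4 ≤ p t := fun t h1 h2 => h.four_le h1 h2
  have hQv : ∀ t ≤ k, ((Q t : ℕ) = p t ∧ (1 ≤ t → ε t = true)) ∨
      (1 ≤ t ∧ ε t = false ∧ (Q t : ℕ) = m + 3 - p t) := by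
    intro t ht
    rcases Nat.eq_zero_or_pos t with rfl | h0
    · left
      rw [hQ0, hp0]
      exact ⟨rfl, fun h => absurd h (by norm_num)⟩
    · rw [hQ t h0 ht, mirror]
      cases ε t
      · right; exact ⟨h0, rfl, rfl⟩
      · left; exact ⟨rfl, fun _ => rfl⟩
  have hdP : ∀ s ≤ k, ∀ t ≤ k, finDist (P s) (P t) = ((p s : ℤ) - p t).natAbs := by
    intro s hs t ht
    rw [finDist, hP s hs, hP t ht]
  have hdQ : ∀ s ≤ k, ∀ t ≤ k, s ≠ t → 4 ≤ finDist (Q s) (Q t) ∧ finDist (Q s) (Q t) + 4 ≤ m + 3 := by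
    intro s hs t ht hst
    have h1 := hsep s hs t ht hst
    have h2 := hlen s hs
    have h3 := hlen t ht
    have h4 := hfour s
    have h5 := hfour t
    unfold finDist
    rcases hQv s hs with ⟨h6, -⟩ | ⟨h6, -, h6'⟩ <;> rcases hQv t ht with ⟨h7, -⟩ | ⟨h7, -, h7'⟩ <;>
      omega
  have hinjP : Set.InjOn P (range (k + 1) : Finset ℕ) := by
    intro s hs t ht hst
    by_contra hne
    have hs' : s ≤ k := by simpa [Nat.lt_succ_iff] using hs
    have ht' : t ≤ k := by simpa [Nat.lt_succ_iff] using ht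
    have h1 := hsep s hs' t ht' hne
    have h2 := hP s hs'
    have h3 := hP t ht'
    rw [hst] at h2
    omega
  have hinjQ : Set.InjOn Q (range (k + 1) : Finset ℕ) := by
    intro s hs t ht hst
    by_contra hne
    have hs' : s ≤ k := by simpa [Nat.lt_succ_iff] using hs
    have ht' : t ≤ k := by simpa [Nat.lt_succ_iff] using ht
    have h1 := (hdQ s hs' t ht' hne).1
    rw [hst, finDist_self] at h1
    omega
  have hi1 : ∀ a, i a = 1 ↔ a = 0 := fun a => by
    rw [h.eq_one_iff, Fin.ext_iff]; rfl
  have hi2 : ∀ a, i a = 2 ↔ ∃ t, 1 ≤ t ∧ t ≤ k ∧ a = P t := by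
    intro a
    rw [h.eq_two_iff]
    constructor
    · rintro ⟨t, h1, h2, h3⟩; exact ⟨t, h1, h2, Fin.ext (by rw [h3, hP t h2])⟩
    · rintro ⟨t, h1, h2, rfl⟩; exact ⟨t, h1, h2, hP t h2⟩
  have hhub : ∀ {i : Fin (m + 3) → ℕ} {P : ℕ → Fin (m + 3)}, (∀ a, i a ≤ 2) → P 0 = 0 →
      (∀ a, i a = 1 ↔ a = 0) → (∀ a, i a = 2 ↔ ∃ t, 1 ≤ t ∧ t ≤ k ∧ a = P t) →
      ∀ a, i a ≠ 0 → ∃ t ≤ k, a = P t := by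
    intro i P hi hP0 h1 h2 a ha
    have := hi a
    interval_cases hia : i a
    · exact absurd rfl ha
    · exact ⟨0, Nat.zero_le k, by rw [hP0]; exact (h1 a).1 hia⟩
    · obtain ⟨t, -, h3, h4⟩ := (h2 a).1 hia
      exact ⟨t, h3, h4⟩
  have hhubi := hhub h.le_two hP0 hi1 hi2
  have hhubj := hhub hj hQ0 hj1 hj2
  have hfari := det_hubMatrix_mod_X_pow r₁ r₂ h.le_two (by
    intro a b hab ha hb
    obtain ⟨s, hs, rfl⟩ := hhubi a ha
    obtain ⟨t, ht, rfl⟩ := hhubi b hb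
    have hst : s ≠ t := fun e => hab (by rw [e])
    have h1 := hsep s hs t ht hst
    have h2 := hlen s hs
    have h3 := hlen t ht
    rw [hdP s hs t ht]
    omega)
  have hfarj := det_hubMatrix_mod_X_pow r₁ r₂ hj (by
    intro a b hab ha hb
    obtain ⟨s, hs, rfl⟩ := hhubj a ha
    obtain ⟨t, ht, rfl⟩ := hhubj b hb
    exact hdQ s hs t ht fun e => hab (by rw [e]))
  have hsumi := two_mul_pairSum (β := fun a => hubWeight r₁ r₂ (i a)) hinjP (by
    intro a ha
    have : i a = 0 := by
      by_contra hne
      obtain ⟨t, ht, rfl⟩ := hhubi a hne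
      exact ha (mem_image_of_mem _ (mem_range.2 (by omega)))
    simp only [this, hubWeight])
  have hsumj := two_mul_pairSum (β := fun a => hubWeight r₁ r₂ (j a)) hinjQ (by
    intro a ha
    have : j a = 0 := by
      by_contra hne
      obtain ⟨t, ht, rfl⟩ := hhubj a hne
      exact ha (mem_image_of_mem _ (mem_range.2 (by omega)))
    simp only [this, hubWeight])
  set D : ℕ → ℕ → ℤ⟦X⟧ := fun s t => if s = t ∨ s = 0 ∨ t = 0 then 0 else
    cycleKernel X (m + 3) (finDist (P s) (P t)) ^ 2
      - cycleKernel X (m + 3) (finDist (Q s) (Q t)) ^ 2 with hD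
  -- Reflection does not change the kernel seen from the 1-hub, so pairs containing it cancel in the
  -- comparison.
  have hzero : ∀ t ≤ k, cycleKernel (X : ℤ⟦X⟧) (m + 3) (finDist (P 0) (P t))
      = cycleKernel X (m + 3) (finDist (Q 0) (Q t)) := by
    intro t ht
    have h1 : finDist (P 0) (P t) = p t := by rw [hdP 0 (Nat.zero_le k) t ht, hp0]; simp
    have h2 : finDist (Q 0) (Q t) = Q t := by rw [hQ0]; simp [finDist]
    rw [h1, h2]
    rcases hQv t ht with ⟨h3, -⟩ | ⟨-, -, h3⟩
    · rw [h3]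
    · have := hlen t ht
      rw [h3, cycleKernel_sub _ (by omega)]
  have hdiff : 2 * (pairSum (fun a => hubWeight r₁ r₂ (i a))
        - pairSum (fun a => hubWeight r₁ r₂ (j a)))
      = X ^ 2 * (r₂ ^ 2 * (4 * ∑ s ∈ range (k + 1), ∑ t ∈ range (k + 1), D s t)) := by
    rw [mul_sub, hsumi, hsumj, ← sum_sub_distrib, mul_sum, mul_sum, mul_sum]
    refine sum_congr rfl fun s hs => ?_
    rw [← sum_sub_distrib, mul_sum, mul_sum, mul_sum]
    refine sum_congr rfl fun t ht => ?_
    have hs' : s ≤ k := by simpa [Nat.lt_succ_iff] using hs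
    have ht' : t ≤ k := by simpa [Nat.lt_succ_iff] using ht
    have hiP0 : i (P 0) = 1 := (hi1 _).2 hP0
    have hjQ0 : j (Q 0) = 1 := (hj1 _).2 hQ0
    have hiP : ∀ t, t ≠ 0 → t ≤ k → i (P t) = 2 := fun t h1 h2 =>
      (hi2 _).2 ⟨t, Nat.one_le_iff_ne_zero.2 h1, h2, rfl⟩
    have hjQ : ∀ t, t ≠ 0 → t ≤ k → j (Q t) = 2 := fun t h1 h2 =>
      (hj2 _).2 ⟨t, Nat.one_le_iff_ne_zero.2 h1, h2, rfl⟩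
    by_cases hst : s = t
    · simp [hD, hst]
    · by_cases hs0 : s = 0
      · subst hs0
        have ht0 : t ≠ 0 := fun e => hst e.symm
        simp only [hD, if_neg hst, hiP0, hjQ0, hiP t ht0 ht', hjQ t ht0 ht', hzero t ht']
        simp
      · by_cases ht0 : t = 0
        · subst ht0
          simp only [hD, if_neg hst, hiP0, hjQ0, hiP s hs0 hs', hjQ s hs0 hs',
            finDist_comm (P s), finDist_comm (Q s), hzero s hs']
          simp
        · simp only [hD, hst, hs0, ht0, or_self, if_false, hiP s hs0 hs', hjQ s hs0 hs',
            hiP t ht0 ht', hjQ t ht0 ht', hubWeight]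
          ring
  have hdvd : (X ^ 15 : ℤ⟦X⟧) ∣ pairSum (fun a => hubWeight r₁ r₂ (i a))
        - pairSum (fun a => hubWeight r₁ r₂ (j a)) := by
    rw [hdet] at hfarj
    refine (dvd_sub hfari hfarj).trans (dvd_of_eq ?_)
    ring
  -- Two weights use up `X ^ 2`. The coefficients up to `X ^ 12` remain, which is just enough to see
  -- distance `6`.
  have hdvd2 : (X ^ 13 : ℤ⟦X⟧) ∣ 4 * ∑ s ∈ range (k + 1), ∑ t ∈ range (k + 1), D s t := by
    have h1 := hdvd.mul_left 2
    rw [hdiff, show 15 = 2 + 13 from rfl, pow_add,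
      mul_dvd_mul_iff_left (pow_ne_zero _ PowerSeries.X_ne_zero)] at h1
    have hu : IsUnit (r₂ ^ 2) := by
      rw [PowerSeries.isUnit_iff_constantCoeff]
      simp [hr₂]
    exact (hu.dvd_mul_left).1 h1
  have hcoeffD : ∀ e, 2 * e < 13 →
      ∑ s ∈ range (k + 1), ∑ t ∈ range (k + 1), coeff (2 * e) (D s t) = 0 := by
    intro e he
    have h1 := PowerSeries.X_pow_dvd_iff.1 hdvd2 (2 * e) he
    have h4 : (4 : ℤ⟦X⟧) = PowerSeries.C (4 : ℤ) := by simp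
    rw [h4, PowerSeries.coeff_C_mul] at h1
    have h2 := (mul_eq_zero.1 h1).resolve_left (by norm_num)
    simpa only [map_sum] using h2
  -- Two 2-hubs on the same side keep their distance. On opposite sides both arcs between them are
  -- longer than `6`: one has length `p s + p t ≥ 12`, the other is bounded below by `lt_length` and
  -- the spacing of hubs.
  have hDval : ∀ e, e ≤ 6 → ∀ s, 1 ≤ s → s ≤ k → ∀ t, 1 ≤ t → t ≤ k → s ≠ t →
      coeff (2 * e) (D s t)
        = if ((p s : ℤ) - p t).natAbs = e ∧ ε s ≠ ε t then 1 else 0 := by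
    intro e he s hs1 hs t ht1 ht hst
    have h1 := hsep s hs t ht hst
    have h2 := hlen s hs
    have h3 := hlen t ht
    have h4 := hfour s hs1 hs
    have h5 := hfour t ht1 ht
    have hcond : ¬ (s = t ∨ s = 0 ∨ t = 0) := by omega
    simp only [hD, if_neg hcond, map_sub]
    rw [coeff_cycleKernel_sq (finDist_lt _ _).le (by omega),
      coeff_cycleKernel_sq (finDist_lt _ _).le (by omega), hdP s hs t ht]
    have h6 : ¬ (m + 3 - ((p s : ℤ) - p t).natAbs = e) := by omega
    rw [if_neg h6, add_zero]
    unfold finDist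
    rcases hQv s hs with ⟨a1, a2⟩ | ⟨-, a2, a1⟩ <;> rcases hQv t ht with ⟨b1, b2⟩ | ⟨-, b2, b1⟩
    · rw [a1, b1, a2 hs1, b2 ht1, if_neg h6]
      simp
    · rw [a2 hs1, b2, if_neg (by omega : ¬ ((Q s : ℤ) - Q t).natAbs = e),
        if_neg (by omega : ¬ m + 3 - ((Q s : ℤ) - Q t).natAbs = e)]
      simp
    · rw [b2 ht1, a2, if_neg (by omega : ¬ ((Q s : ℤ) - Q t).natAbs = e),
        if_neg (by omega : ¬ m + 3 - ((Q s : ℤ) - Q t).natAbs = e)]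
      simp
    · have h7 : ((Q s : ℤ) - Q t).natAbs = ((p s : ℤ) - p t).natAbs := by omega
      rw [a2, b2, h7, if_neg h6]
      simp
  -- Short pairs can only be lost, never gained. As the total is zero, no pair is lost.
  have hnonneg : ∀ e, e ≤ 6 → ∀ s ∈ range (k + 1), ∀ t ∈ range (k + 1),
      0 ≤ coeff (2 * e) (D s t) := by
    intro e he s hs t ht
    by_cases hcond : s = t ∨ s = 0 ∨ t = 0
    · simp [hD, hcond]
    · have hs' : s ≤ k := by simpa [Nat.lt_succ_iff] using hs
      have ht' : t ≤ k := by simpa [Nat.lt_succ_iff] using ht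
      rw [hDval e he s (by omega) hs' t (by omega) ht' (by omega)]
      split_ifs <;> norm_num
  have hall : ∀ e, e ≤ 6 → ∀ s ∈ range (k + 1), ∀ t ∈ range (k + 1),
      coeff (2 * e) (D s t) = 0 := by
    intro e he s hs t ht
    have h1 := hcoeffD e (by omega)
    rw [sum_eq_zero_iff_of_nonneg fun s hs => sum_nonneg fun t ht => hnonneg e he s hs t ht] at h1
    exact (sum_eq_zero_iff_of_nonneg fun t ht => hnonneg e he s hs t ht).1 (h1 s hs) t ht
  by_contra hne
  have hgap := h.step t htk
  have key : ∀ e, e ≤ 6 → ((p t : ℤ) - p (t + 1)).natAbs = e → False := by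
    intro e he hd
    have h1 := hall e he t (mem_range.2 (by omega)) (t + 1) (mem_range.2 (by omega))
    rw [hDval e he t ht1 htk.le (t + 1) (by omega) htk (by omega), if_pos ⟨hd, hne⟩] at h1
    exact one_ne_zero h1
  rcases hgap with hg | hg
  · exact key 4 (by norm_num) (by omega)
  · exact key 6 le_rfl (by omega)

/-! ### Symmetries of the cycle and the conclusion. -/

/-- Sun graphs whose leaf counts differ by a symmetry of the cycle are isomorphic. -/
theorem nonempty_sunGraph_comp_iso {n : ℕ} (i : Fin n → ℕ) (τ : cycleGraph n ≃g cycleGraph n) :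
    Nonempty (sunGraph (i ∘ τ) ≃g sunGraph i) := by
  refine ⟨⟨Equiv.sumCongr τ.toEquiv
    (Equiv.sigmaCongrLeft (β := fun a => Fin (i a)) τ.toEquiv), ?_⟩⟩
  rintro (a | ⟨a, x⟩) (b | ⟨b, y⟩)
  · exact τ.map_adj_iff
  · exact τ.injective.eq_iff
  · exact τ.injective.eq_iff
  · exact Iff.rfl

/-- Rotation of the cycle. -/
def cycleRotate {m : ℕ} (c : Fin (m + 3)) : cycleGraph (m + 3) ≃g cycleGraph (m + 3) where
  toEquiv := Equiv.addRight c
  map_rel_iff' {a b} := by simp [cycleGraph_adj]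

/-- Reflection of the cycle. -/
def cycleReflect (m : ℕ) : cycleGraph (m + 3) ≃g cycleGraph (m + 3) where
  toEquiv := Equiv.neg _
  map_rel_iff' {a b} := by
    simp only [Equiv.neg_apply, cycleGraph_adj, neg_sub_neg]
    exact or_comm

theorem HubCounts.comp {n k : ℕ} {i : Fin n → ℕ} (h : HubCounts k i) (τ : Fin n ≃ Fin n) :
    HubCounts k (i ∘ τ) := by
  have key : ∀ c, #{a | (i ∘ τ) a = c} = #{a | i a = c} := by
    intro c
    rw [← card_map τ.toEmbedding]
    congr 1
    ext a
    simp only [mem_map, mem_filter, mem_univ, true_and, Function.comp_apply]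
    constructor
    · rintro ⟨b, hb, rfl⟩; exact hb
    · intro ha; exact ⟨τ.symm a, by simpa using ha, by simp⟩
  exact ⟨fun a => h.le_two _, by rw [key, h.card_one], by rw [key, h.card_two]⟩

theorem HubCounts.eq_one_iff {m k : ℕ} {i : Fin (m + 3) → ℕ} (h : HubCounts k i) (h0 : i 0 = 1)
    (a : Fin (m + 3)) : i a = 1 ↔ a = 0 := by
  obtain ⟨b, hb⟩ := card_eq_one.1 h.card_one
  have h1 : ∀ a, i a = 1 ↔ a = b := fun a => by
    have : a ∈ univ.filter (fun a => i a = 1) ↔ a ∈ ({b} : Finset _) := by rw [hb]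
    simpa using this
  rw [h1, (h1 0).1 h0]

/-- Leaf counts with equal vertices with one and with two leaves are equal. -/
theorem HubCounts.eq_of_forall_eq_two {m k : ℕ} {i j : Fin (m + 3) → ℕ} (hi : HubCounts k i)
    (hj : HubCounts k j) (hi0 : i 0 = 1) (hj0 : j 0 = 1) (h : ∀ a, i a = 2 → j a = 2) : j = i := by
  have hsub : univ.filter (fun a => i a = 2) ⊆ univ.filter (fun a => j a = 2) := by
    intro a ha
    simp only [mem_filter, mem_univ, true_and] at ha ⊢
    exact h a ha
  have heq := eq_of_subset_of_card_le hsub (by rw [hi.card_two, hj.card_two])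
  funext a
  have h1 : i a = 1 ↔ j a = 1 := by rw [hi.eq_one_iff hi0, hj.eq_one_iff hj0]
  have h2 : i a = 2 ↔ j a = 2 := by
    have : a ∈ univ.filter (fun a => i a = 2) ↔ a ∈ univ.filter (fun a => j a = 2) := by rw [heq]
    simpa using this
  have := hi.le_two a
  have := hj.le_two a
  omega

theorem NicePattern.hubCounts {n k : ℕ} {i : Fin n → ℕ} {p : ℕ → ℕ} (h : NicePattern k i p) :
    HubCounts k i := by
  have hn := h.length_ge
  refine ⟨h.le_two, ?_, ?_⟩
  · rw [card_eq_one]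
    refine ⟨⟨0, by omega⟩, ?_⟩
    ext a
    simp only [mem_filter, mem_univ, true_and, mem_singleton, h.eq_one_iff, Fin.ext_iff]
  · have hlt : ∀ t ∈ Icc 1 k, p t < n := by
      intro t ht
      rw [mem_Icc] at ht
      have := h.lt_length ht.1 ht.2
      omega
    have himg : (univ.filter (fun a => i a = 2)).map Fin.valEmbedding = (Icc 1 k).image p := by
      ext x
      simp only [mem_map, mem_filter, mem_univ, true_and, mem_image, h.eq_two_iff,
        Fin.valEmbedding_apply]
      constructor
      · rintro ⟨a, ⟨t, h1, h2, h3⟩, rfl⟩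
        exact ⟨t, mem_Icc.2 ⟨h1, h2⟩, h3.symm⟩
      · rintro ⟨t, ht, rfl⟩
        exact ⟨⟨p t, hlt t ht⟩, ⟨t, (mem_Icc.1 ht).1, (mem_Icc.1 ht).2, rfl⟩, rfl⟩
    rw [← card_map Fin.valEmbedding, himg, card_image_of_injOn, Nat.card_Icc, Nat.add_sub_cancel]
    intro s hs t ht hst
    have hs' := mem_Icc.1 (mem_coe.1 hs)
    have ht' := mem_Icc.1 (mem_coe.1 ht)
    by_contra hne
    rcases lt_or_gt_of_ne hne with hlt | hlt
    · have := h.add_le hlt ht'.2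
      omega
    · have := h.add_le hlt hs'.2
      omega

/-- Hubs are at least `4` apart along the pattern, and the arc closing up the cycle is long since
all hubs lie in one half. -/
theorem NicePattern.not_adj {m k : ℕ} {i : Fin (m + 3) → ℕ} {p : ℕ → ℕ} (h : NicePattern k i p)
    (a b : Fin (m + 3)) (hab : (cycleGraph (m + 3)).Adj a b) : i a = 0 ∨ i b = 0 := by
  by_contra hne
  push Not at hne
  have hn := h.length_ge
  have hub : ∀ a, i a ≠ 0 → ∃ t ≤ k, a.val = p t := by
    intro a ha
    have := h.le_two a
    by_cases h1 : i a = 1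
    · exact ⟨0, Nat.zero_le k, by rw [h.zero]; exact (h.eq_one_iff a).1 h1⟩
    · obtain ⟨t, -, h2, h3⟩ := (h.eq_two_iff a).1 (by omega)
      exact ⟨t, h2, h3⟩
  have hlen : ∀ t ≤ k, 2 * p t + 4 ≤ m + 3 := by
    intro t ht
    rcases Nat.eq_zero_or_pos t with rfl | h0
    · rw [h.zero]; omega
    · exact h.lt_length h0 ht
  obtain ⟨s, hs, has⟩ := hub a hne.1
  obtain ⟨t, ht, hbt⟩ := hub b hne.2
  have h1 := hlen s hs
  have h2 := hlen t ht
  have hst : a = b ∨ p s + 4 ≤ p t ∨ p t + 4 ≤ p s := by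
    rcases lt_trichotomy s t with hlt | rfl | hlt
    · exact Or.inr (Or.inl (h.add_le hlt ht))
    · exact Or.inl (Fin.ext (by rw [has, hbt]))
    · exact Or.inr (Or.inr (h.add_le hlt hs))
  have hne' : a ≠ b := hab.ne
  have hcases : ∀ a b : Fin (m + 3), (a - b).val = 1 →
      a.val = b.val + 1 ∨ a.val + (m + 3) = b.val + 1 := by
    intro a b hab
    rcases le_or_gt b a with hle | hlt
    · rw [Fin.sub_val_of_le hle] at hab
      omega
    · rw [Fin.coe_sub_iff_lt.2 hlt] at hab
      omega
  have hst' := hst.resolve_left hne'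
  rcases cycleGraph_adj'.1 hab with hd | hd
  · have := hcases _ _ hd
    omega
  · have := hcases _ _ hd
    omega

/-- A sun graph with the same Laplacian spectrum as a nice one has the same leaf counts up to
reflection, once the vertices with one leaf are aligned. -/
theorem NicePattern.eq_or_eq_reflect {m k : ℕ} {i j : Fin (m + 3) → ℕ} {p : ℕ → ℕ}
    (h : NicePattern k i p) (hj : HubCounts k j) (hj0 : j 0 = 1)
    (hspec : (sunGraph j).lapSpectrum = (sunGraph i).lapSpectrum) :
    j = i ∨ j ∘ cycleReflect m = i := by
  obtain ⟨r₁, r₂, hr₁, hr₂, hdet⟩ := exists_det_hubMatrix_eq m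
  have hi := h.hubCounts
  have hdet := hdet k i j hi hj hspec
  have hi0 : i 0 = 1 := (h.eq_one_iff 0).2 rfl
  have hi1 := hi.eq_one_iff hi0
  have hj1 := hj.eq_one_iff hj0
  have hn := h.length_ge
  have hlt : ∀ t ≤ k, p t < m + 3 := by
    intro t ht
    rcases Nat.eq_zero_or_pos t with rfl | h0
    · rw [h.zero]; omega
    · have := h.lt_length h0 ht
      omega
  let P : ℕ → Fin (m + 3) := fun t => Fin.ofNat (m + 3) (p t)
  have hP : ∀ t ≤ k, (P t : ℕ) = p t := fun t ht => Nat.mod_eq_of_lt (hlt t ht)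
  have hPne : ∀ t, 1 ≤ t → t ≤ k → P t ≠ 0 := by
    intro t h1 h2 h3
    have h4 := h.four_le h1 h2
    have h5 := hP t h2
    rw [h3] at h5
    simp only [Fin.val_zero] at h5
    omega
  have hPneg : ∀ t, 1 ≤ t → t ≤ k → ((-P t : Fin (m + 3)) : ℕ) = m + 3 - p t := by
    intro t h1 h2
    rw [val_neg_of_ne_zero (hPne t h1 h2), hP t h2]
  have hiP : ∀ t, 1 ≤ t → t ≤ k → i (P t) = 2 := fun t h1 h2 =>
    (h.eq_two_iff _).2 ⟨t, h1, h2, hP t h2⟩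
  have hineg : ∀ t, 1 ≤ t → t ≤ k → i (-P t) ≠ 2 := by
    intro t h1 h2 h3
    obtain ⟨s, h4, h5, h6⟩ := (h.eq_two_iff _).1 h3
    rw [hPneg t h1 h2] at h6
    have := h.lt_length h1 h2
    have := h.lt_length h4 h5
    omega
  -- A nice graph has a 2-hub at exactly one of `P t` and `-P t`, so by parity `j` also has one at
  -- exactly one of them.
  have hjP : ∀ t, 1 ≤ t → t ≤ k → (j (P t) = 2 ∧ j (-P t) ≠ 2) ∨ (j (P t) ≠ 2 ∧ j (-P t) = 2) := by
    intro t h1 h2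
    have key := indicator_add_indicator_neg_eq hr₁ hr₂ h.le_two hi1 hj.le_two hj1 hdet
      (hPne t h1 h2)
    rw [if_pos (hiP t h1 h2), if_neg (hineg t h1 h2)] at key
    by_cases h3 : j (P t) = 2 <;> by_cases h4 : j (-P t) = 2
    · rw [if_pos h3, if_pos h4] at key
      exact absurd key (by decide)
    · exact Or.inl ⟨h3, h4⟩
    · exact Or.inr ⟨h3, h4⟩
    · rw [if_neg h3, if_neg h4] at key
      exact absurd key (by decide)
  let ε : ℕ → Bool := fun t => decide (j (P t) = 2)
  let Q : ℕ → Fin (m + 3) := fun t => if t = 0 then 0 else if ε t then P t else -P t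
  have hQ0 : Q 0 = 0 := if_pos rfl
  have hQt : ∀ t, 1 ≤ t → Q t = if ε t then P t else -P t := fun t ht =>
    if_neg (Nat.one_le_iff_ne_zero.1 ht)
  have hQ : ∀ t, 1 ≤ t → t ≤ k → (Q t : ℕ) = mirror (m + 3) p ε t := by
    intro t h1 h2
    rw [hQt t h1, mirror]
    cases ε t
    · exact hPneg t h1 h2
    · exact hP t h2
  have hjQ : ∀ t, 1 ≤ t → t ≤ k → j (Q t) = 2 := by
    intro t h1 h2
    rw [hQt t h1]
    rcases hjP t h1 h2 with ⟨h3, h4⟩ | ⟨h3, h4⟩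
    · rw [if_pos (by simpa [ε] using h3)]; exact h3
    · rw [if_neg (by simpa [ε] using h3)]; exact h4
  have hQinj : Set.InjOn Q (Icc 1 k : Finset ℕ) := by
    intro s hs t ht hst
    have hs' := mem_Icc.1 (mem_coe.1 hs)
    have ht' := mem_Icc.1 (mem_coe.1 ht)
    have h1 := hQ s hs'.1 hs'.2
    have h2 := hQ t ht'.1 ht'.2
    rw [hst, h2] at h1
    have h3 := h.lt_length hs'.1 hs'.2
    have h4 := h.lt_length ht'.1 ht'.2
    simp only [mirror] at h1
    by_contra hne
    have h5 : p s + 4 ≤ p t ∨ p t + 4 ≤ p s := by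
      rcases lt_or_gt_of_ne hne with hlt | hlt
      · exact Or.inl (h.add_le hlt ht'.2)
      · exact Or.inr (h.add_le hlt hs'.2)
    split_ifs at h1 <;> omega
  have hj2 : ∀ a, j a = 2 ↔ ∃ t, 1 ≤ t ∧ t ≤ k ∧ a = Q t := by
    have hsub : (Icc 1 k).image Q ⊆ univ.filter (fun a => j a = 2) := by
      intro a ha
      obtain ⟨t, ht, rfl⟩ := mem_image.1 ha
      rw [mem_Icc] at ht
      exact mem_filter.2 ⟨mem_univ _, hjQ t ht.1 ht.2⟩
    -- The `k` chosen positions are distinct, so they exhaust the 2-hubs of `j`.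
    have heq := eq_of_subset_of_card_le hsub (by
      rw [hj.card_two, card_image_of_injOn hQinj, Nat.card_Icc, Nat.add_sub_cancel])
    intro a
    have : a ∈ (Icc 1 k).image Q ↔ a ∈ univ.filter (fun a => j a = 2) := by rw [heq]
    simp only [mem_image, mem_filter, mem_univ, true_and, mem_Icc] at this
    rw [← this]
    constructor
    · rintro ⟨t, ⟨h1, h2⟩, rfl⟩; exact ⟨t, h1, h2, rfl⟩
    · rintro ⟨t, h1, h2, rfl⟩; exact ⟨t, ⟨h1, h2⟩, rfl⟩
  have hside : ∀ t, 1 ≤ t → t ≤ k → ε t = ε 1 := by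
    intro t h1
    induction t, h1 using Nat.le_induction with
    | base => exact fun _ => rfl
    | succ t ht ih =>
      intro h2
      rw [← ih (by omega)]
      exact (side_eq_of_pairSum h hr₂ hP hQ0 hQ hj.le_two hj1 hj2 hdet ht (by omega)).symm
  have hiex : ∀ a, i a = 2 → ∃ t, 1 ≤ t ∧ t ≤ k ∧ a = P t := by
    intro a ha
    obtain ⟨t, h1, h2, h3⟩ := (h.eq_two_iff a).1 ha
    exact ⟨t, h1, h2, Fin.ext (by rw [h3, hP t h2])⟩
  cases h1 : ε 1
  · right
    refine hi.eq_of_forall_eq_two (hj.comp (cycleReflect m).toEquiv) hi0 ?_ ?_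
    · change j (-0) = 1
      rw [neg_zero, hj0]
    · intro a ha
      obtain ⟨t, ht1, htk, rfl⟩ := hiex a ha
      have := hside t ht1 htk
      rw [h1] at this
      have h3 : ¬ j (P t) = 2 := by simpa [ε] using this
      exact ((hjP t ht1 htk).resolve_left fun h => h3 h.1).2
  · left
    refine hi.eq_of_forall_eq_two hj hi0 hj0 ?_
    intro a ha
    obtain ⟨t, ht1, htk, rfl⟩ := hiex a ha
    have := hside t ht1 htk
    rw [h1] at this
    simpa [ε] using this

end SimpleGraph

theorem lemma2p3 {V : Type u} [Fintype V] [DecidableEq V] (G : SimpleGraph V)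
    [DecidableRel G.Adj] (ℓ k : ℕ) (hG : G.IsNice ℓ k) :
    SimpleGraph.IsDeterminedByLapSpectrum.{u, v} G := by
  intro W _ _ H _ hspec
  obtain ⟨m, rfl⟩ : ∃ m, ℓ = m + 3 := by
    have h15 : 15 ≤ ℓ := (le_max_right _ _).trans hG.2.1
    exact ⟨ℓ - 3, by omega⟩
  obtain ⟨i, p, hp, ⟨eG⟩⟩ := hG.exists_pattern
  rw [← SimpleGraph.lapSpectrum_eq_of_iso eG] at hspec
  obtain ⟨j, hj, ⟨eH⟩⟩ :=
    SimpleGraph.exists_sunGraph_iso_of_lapSpectrum_eq hp.hubCounts hp.not_adj hspec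
  obtain ⟨c, hc⟩ := Finset.card_eq_one.1 hj.card_one
  have hjc : j c = 1 := by
    have : c ∈ Finset.univ.filter (fun a => j a = 1) := by rw [hc]; simp
    simpa using this
  -- Rotate the cycle so that the 1-hub sits at position `0`; only the reflection remains ambiguous.
  have hj' : SimpleGraph.HubCounts k (j ∘ SimpleGraph.cycleRotate c) :=
    hj.comp (SimpleGraph.cycleRotate c).toEquiv
  obtain ⟨eR⟩ := SimpleGraph.nonempty_sunGraph_comp_iso j (SimpleGraph.cycleRotate c)
  set j' := j ∘ SimpleGraph.cycleRotate c
  have hj0 : j' 0 = 1 := by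
    change j (0 + c) = 1
    rw [zero_add, hjc]
  rw [← SimpleGraph.lapSpectrum_eq_of_iso (eR.trans eH)] at hspec
  rcases hp.eq_or_eq_reflect hj' hj0 hspec with heq | heq
  · rw [← heq] at eG
    exact ⟨(eR.trans eH).symm.trans eG⟩
  · obtain ⟨eF⟩ := SimpleGraph.nonempty_sunGraph_comp_iso j' (SimpleGraph.cycleReflect m)
    rw [heq] at eF
    exact ⟨((eR.trans eH).symm.trans eF.symm).trans eG⟩
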